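/- Let $L=\{L(t)\}_{t\in\mathbb R}$ be Cauchy motion: $L(0)=0$ almost surely, $L$ has independent increments, and $L(t)-L(s)$ has the Cauchy distribution $C(0,|t-s|)$ with location $0$ and scale $|t-s|$. Let $\mathrm{CI}_1(0,1)$ be the distribution of the stochastic integral $Z=\int_0^1(1,x)\,\mathrm dL(x)\in\mathbb R^2$ (the limit in probability of Riemann sums along tagged partitions whose mesh tends to $0$). For $x=(x_1,x_2)\in\mathbb R^2$ let $Q=1-2ix_1+x_1^2+4ix_2$, $$g(x)=\frac1\pi\bigl(1+x_1^2+(2x_2-x_1)^2\bigr)^{-3/2},$$ and $$f(x)=\frac{4/\pi^2}{1+6x_1^2+x_1^4-16x_1x_2+16x_2^2}+\frac2{\pi^2}\,\Re\left(\frac{\operatorname{atan}\bigl(iQ^{1/2}/(x_1-2x_2)\bigr)}{Q^{3/2}}\right)\quad\text{if }x_1\neq 2x_2,$$ $$f(x)=\frac{4/\pi^2}{(1+x_1^2)^2}+\frac1{\pi(1+x_1^2)^{3/2}}\quad\text{if }x_1=2x_2,$$ with principal branches. There is an exact sampler for $\mathrm{CI}_1(0,1)$ that uses, in expectation, a constant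 number of samples, all of them independent samples from $N(0,1)$ and $\chi^2(1)$. Namely, consider the following rejection sampler. Each round draws fresh independent $Y_1,Y_2,V_1,V_2\sim N(0,1)$ and $W\sim\chi^2(1)$, and forms the proposal $X=\bigl(Y_1/\sqrt W,\ (Y_1+Y_2)/(2\sqrt W)\bigr)$ and $U=\exp(-(V_1^2+V_2^2)/2)$, which is uniform on $(0,1]$. If $U\cdot\frac{25}{\pi}\,g(X)\le f(X)$, the sampler outputs $X$ and halts; otherwise it starts a new round. Then: 1. the proposal $X$ has the bivariate Student density $g$, and $f(x)\le\frac{25}{\pi}\,g(x)$ for all $x\in\mathbb R^2$; 2. the sampler halts almost surely, and its output has exactly the distribution $\mathrm{CI}_1(0,1)$; 3. until it halts, it uses in expectation exactly $100/\pi$ samples from $N(0,1)$ and $25/\pi$ samples from $\chi^2(1)$. -/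

import Mathlib

open MeasureTheory ProbabilityTheory Filter Topology
open scoped ENNReal NNReal

/-! ### Cauchy motion, stochastic integrals, and the vector integrand `(1, x)` -/

/-- Cauchy motion: `L 0 = 0`, independent increments, and `L t - L s` has the Cauchy distribution
`C(0, |t - s|)` (location `0`, scale `|t - s|`). -/
structure IsCauchyMotion {Ω : Type*} [MeasurableSpace Ω] (L : ℝ → Ω → ℝ) (P : Measure Ω) :
    Prop where
  zero : ∀ᵐ ω ∂P, L 0 ω = 0
  indep : HasIndepIncrements L P
  law : ∀ s t : ℝ, HasLaw (fun ω => L t ω - L s ω) (cauchyMeasure 0 (Real.nnabs (t - s))) P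

/-- The points `t 0 ≤ t 1 ≤ ... ≤ t n` form a partition of `[a, b]` of mesh at most `δ`, with
tags `ξ k ∈ [t k, t (k + 1)]`. Only the values `t 0, ..., t n` and `ξ 0, ..., ξ (n - 1)` matter. -/
structure IsTaggedPartition (a b δ : ℝ) (n : ℕ) (t ξ : ℕ → ℝ) : Prop where
  left : t 0 = a
  right : t n = b
  mono : ∀ k < n, t k ≤ t (k + 1)
  tag : ∀ k < n, ξ k ∈ Set.Icc (t k) (t (k + 1))
  mesh : ∀ k < n, t (k + 1) - t k ≤ δ

/-- The Riemann sum `∑ₖ (L (t (k + 1)) - L (t k)) φ (ξ k)`. -/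
def stochRiemannSum {Ω E : Type*} [AddCommGroup E] [Module ℝ E] (L : ℝ → Ω → ℝ) (φ : ℝ → E)
    (n : ℕ) (t ξ : ℕ → ℝ) (ω : Ω) : E :=
  ∑ k ∈ Finset.range n, (L (t (k + 1)) ω - L (t k) ω) • φ (ξ k)

/-- `Z` is (a version of) the stochastic integral `∫_a^b φ dL` of the deterministic function `φ`:
the limit in probability of the Riemann sums, along every sequence of tagged partitions of
`[a, b]` whose mesh tends to `0`. -/
def IsStochIntegral {Ω E : Type*} [MeasurableSpace Ω] [NormedAddCommGroup E] [NormedSpace ℝ E]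
    [MeasurableSpace E] (L : ℝ → Ω → ℝ) (P : Measure Ω) (φ : ℝ → E) (a b : ℝ) (Z : Ω → E) :
    Prop :=
  AEMeasurable Z P ∧
    ∀ (δ : ℕ → ℝ) (n : ℕ → ℕ) (t ξ : ℕ → ℕ → ℝ), Tendsto δ atTop (𝓝 0) →
      (∀ m, IsTaggedPartition a b (δ m) (n m) (t m) (ξ m)) →
      TendstoInMeasure P (fun m => stochRiemannSum L φ (n m) (t m) (ξ m)) atTop Z

/-- The integrand `x ↦ (1, x)`. If `Z` is the integral of it over `[0, 1]` with respect to a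
Cauchy motion, then the law of `Z` is the distribution `CI₁(0, 1)`. -/
noncomputable def oneX (x : ℝ) : EuclideanSpace ℝ (Fin 2) := !₂[1, x]

/-! ### Samplers with access to `N(0, 1)` and `χ²(1)` samples -/

/-- The chi-squared distribution with one degree of freedom: the law of the square of a standard
normal random variable. -/
noncomputable def chiSqOne : Measure ℝ := (gaussianReal 0 1).map (fun x => x ^ 2)

/-- A finite sampling procedure: it either returns a result, or draws a fresh sample from `N(0, 1)`
or from `χ²(1)` and continues, depending on the value drawn. -/
inductive SamplingTree (α : Type) : Type
  | done (r : α) : SamplingTree α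
  | normal (next : ℝ → SamplingTree α) : SamplingTree α
  | chiSq (next : ℝ → SamplingTree α) : SamplingTree α

/-- Run a sampling procedure, the successive `N(0, 1)` samples being `N i, N (i + 1), ...` and the
successive `χ²(1)` samples being `W j, W (j + 1), ...`. It returns the result together with the
indices of the first unused samples of both kinds. -/
def SamplingTree.run {α : Type} (N W : ℕ → ℝ) : SamplingTree α → ℕ → ℕ → α × ℕ × ℕ
  | .done r, i, j => (r, i, j)
  | .normal next, i, j => (next (N i)).run N W (i + 1) j
  | .chiSq next, i, j => (next (W j)).run N W i (j + 1)

namespace SamplingTree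

/-! A procedure `R` with results in `Option α` (`none`: reject, `some x`: accept `x`) is repeated,
with fresh samples, until it accepts. -/

variable {α : Type} (R : SamplingTree (Option α)) (N W : ℕ → ℝ)

/-- The numbers of `N(0, 1)` samples and of `χ²(1)` samples that the first `m` rounds use. -/
def used : ℕ → ℕ × ℕ
  | 0 => (0, 0)
  | m + 1 => (R.run N W (used m).1 (used m).2).2

/-- The result of round `m` (the first round is round `0`). -/
def result (m : ℕ) : Option α := (R.run N W (R.used N W m).1 (R.used N W m).2).1

/-- Some round accepts. -/
def Halts : Prop := ∃ m, (R.result N W m).isSome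

/-- The first accepting round (`0` if there is none). -/
noncomputable def haltRound : ℕ := sInf {m | (R.result N W m).isSome}

/-- The output of the sampler: the result of the first accepting round
(an arbitrary value if there is none). -/
noncomputable def output [Inhabited α] : α := (R.result N W (R.haltRound N W)).getD default

open Classical in
/-- The number of `N(0, 1)` samples used until the sampler halts, `∞` if it does not halt. -/
noncomputable def normalsUsed : ℝ≥0∞ :=
  if R.Halts N W then ((R.used N W (R.haltRound N W + 1)).1 : ℝ≥0∞) else ∞

open Classical in
/-- The number of `χ²(1)` samples used until the sampler halts, `∞` if it does not halt. -/
noncomputable def chiSqsUsed : ℝ≥0∞ :=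
  if R.Halts N W then ((R.used N W (R.haltRound N W + 1)).2 : ℝ≥0∞) else ∞

end SamplingTree

/-! ### The rejection sampler with the bivariate Student envelope -/

/-- The bivariate Student density
`g(x₁, x₂) = (1/π) (1 + x₁² + (2 x₂ - x₁)²)^(-3/2)` with one degree of freedom. -/
noncomputable def studentDensity (x : EuclideanSpace ℝ (Fin 2)) : ℝ :=
  1 / Real.pi * (1 + x 0 ^ 2 + (2 * x 1 - x 0) ^ 2) ^ (-(3 / 2) : ℝ)

/-- The proposal `A Y / √W` made from `Y = (y₁, y₂)` and `w`, with `A` the lower triangular matrix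
with rows `(1, 0)` and `(1/2, 1/2)`; `A Aᵀ` is the scale matrix of `studentDensity`. -/
noncomputable def studentProposal (y₁ y₂ w : ℝ) : EuclideanSpace ℝ (Fin 2) :=
  !₂[y₁ / √w, (y₁ + y₂) / (2 * √w)]

/-- `Q = 1 - 2 i x₁ + x₁² + 4 i x₂`. -/
noncomputable def ciQ (x : EuclideanSpace ℝ (Fin 2)) : ℂ :=
  1 - 2 * Complex.I * (x 0 : ℂ) + (x 0 : ℂ) ^ 2 + 4 * Complex.I * (x 1 : ℂ)

open Classical in
/-- The closed form of the density of `CI₁(0, 1)` that the sampler evaluates. -/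
noncomputable def ciDensity (x : EuclideanSpace ℝ (Fin 2)) : ℝ :=
  if x 0 = 2 * x 1 then
    (4 / Real.pi ^ 2) / (1 + x 0 ^ 2) ^ 2 + 1 / (Real.pi * (1 + x 0 ^ 2) ^ (3 / 2 : ℝ))
  else
    (4 / Real.pi ^ 2) / (1 + 6 * x 0 ^ 2 + x 0 ^ 4 - 16 * x 0 * x 1 + 16 * x 1 ^ 2)
      + 2 / Real.pi ^ 2 *
        (Complex.arctan (Complex.I * ciQ x ^ (1 / 2 : ℂ) / ((x 0 - 2 * x 1 : ℝ) : ℂ))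
          / ciQ x ^ (3 / 2 : ℂ)).re

open Classical in
/-- One round of the rejection sampler: draw `y₁, y₂` from `N(0, 1)` and `w` from `χ²(1)`, form the
Student proposal `x`, draw `v₁, v₂` from `N(0, 1)`, so that `u = exp (-(v₁² + v₂²) / 2)` is uniform
on `(0, 1]`, and accept `x` if `u * (25 / π) * g x ≤ f x`. -/
noncomputable def ciRound : SamplingTree (Option (EuclideanSpace ℝ (Fin 2))) :=
  .normal fun y₁ => .normal fun y₂ => .chiSq fun w => .normal fun v₁ => .normal fun v₂ => .done <|
    if Real.exp (-(v₁ ^ 2 + v₂ ^ 2) / 2) * (25 / Real.pi * studentDensity (studentProposal y₁ y₂ w))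
        ≤ ciDensity (studentProposal y₁ y₂ w)
    then some (studentProposal y₁ y₂ w) else none

/-! ### The complex quantities in the density, in the coordinates `s = x₁`, `d = x₁ - 2 x₂` -/

/-! An increment of length h of a Cauchy motion has characteristic function exp(-h|u|), so by
independence Z has characteristic function exp(-∫₀¹ |u₁ + u₂ x| dx). The target density is found by
inverting this transform explicitly.

The exponent is homogeneous of degree one. With a = q(t + 1) and b = -2q it becomes |q| `huber t`,
and the phase becomes q(s t + d), where s = x₁ and d = x₁ - 2x₂. The Jacobian is 2|q|, the integral
over q is elementary, and what remains is π⁻² Re ∫ (`huber t` - i(s t + d))⁻² dt. Since `huber` is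
(1 + t²)/2 on [-1, 1] and |t| outside, the integrand is rational on three pieces. Their sum is the
arctangent formula (`integral_dirKernel`), whose branch is settled by `stableAngle_eq`.

For the envelope, put C = √Q and c = ‖C‖. If |d| dominates c, the linear Taylor term of the
arctangent cancels the rational term 4/|Q|² and the cubic term is purely imaginary, leaving
O(|d|⁻³). Otherwise direct bounds suffice: the bound for the imaginary part of the angle is only
logarithmic in 1/|d|, and Im C³ = O(c|d|) absorbs it.

The closed form is not visibly nonnegative. Positivity is recovered almost everywhere from the fact
that a genuine measure has this Fourier transform (`eq_withDensity_of_charFun`). The total mass is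
obtained without a Cauchy motion at hand: `exists_charFun_eq_exp_neg_ciExponent` produces the law as
a weak limit of sums of independent Cauchy vectors.

Finally, a round accepts a proposal x with probability π f(x)/(25 g(x)), where negative values count
as 0. Accepted proposals therefore have sub-density (π/25) f, and a round succeeds with probability
π/25. The rounds are i.i.d., so the first success has the conditional law, and 25/π rounds are
needed on average, each costing four normals and one χ² sample. -/

/-- `1 + s² - 2 i d`. -/
noncomputable def stableQ (s d : ℝ) : ℂ := ⟨1 + s ^ 2, -2 * d⟩

/-- The principal square root of `stableQ`. -/
noncomputable def stableRoot (s d : ℝ) : ℂ := stableQ s d ^ (1 / 2 : ℂ)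

open Classical in
/-- The angle `arctan (i √Q / d)`, extended by continuity to `d = 0`. -/
noncomputable def stableAngle (s d : ℝ) : ℂ :=
  if d = 0 then (Real.pi / 2 : ℝ) else Complex.arctan (Complex.I * stableRoot s d / (d : ℂ))

@[simp] lemma stableQ_re (s d : ℝ) : (stableQ s d).re = 1 + s ^ 2 := rfl

@[simp] lemma stableQ_im (s d : ℝ) : (stableQ s d).im = -2 * d := rfl

lemma stableQ_ne_zero (s d : ℝ) : stableQ s d ≠ 0 := by
  intro h
  have := congrArg Complex.re h
  simp at this
  nlinarith [sq_nonneg s]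

lemma stableQ_eq (s d : ℝ) : stableQ s d = 1 + (s : ℂ) ^ 2 - 2 * Complex.I * d := by
  apply Complex.ext <;> simp [sq]

lemma stableRoot_sq (s d : ℝ) : stableRoot s d ^ 2 = stableQ s d := by
  rw [stableRoot, ← Complex.cpow_nat_mul]
  norm_num

lemma stableRoot_ne_zero (s d : ℝ) : stableRoot s d ≠ 0 := by
  intro h
  have := stableRoot_sq s d
  rw [h] at this
  exact stableQ_ne_zero s d (by rw [← this]; simp)

lemma stableQ_cpow_three_halves (s d : ℝ) :
    stableQ s d ^ (3 / 2 : ℂ) = stableRoot s d ^ 3 := by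
  rw [stableRoot, ← Complex.cpow_nat_mul]
  norm_num

/-- Re Q > 0 puts the argument of Q in (-π/2, π/2), and the square root halves it. -/
lemma stableRoot_re_pos (s d : ℝ) : 0 < (stableRoot s d).re := by
  rw [stableRoot, Complex.cpow_def_of_ne_zero (stableQ_ne_zero s d), Complex.exp_re]
  refine mul_pos (Real.exp_pos _) (Real.cos_pos_of_mem_Ioo ?_)
  have h : (Complex.log (stableQ s d) * (1 / 2)).im = Complex.arg (stableQ s d) / 2 := by
    simp [Complex.mul_im, Complex.log_im]
    ring
  have h2 := (Complex.abs_arg_lt_pi_div_two_iff (z := stableQ s d)).2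
    (Or.inl (by simp; positivity))
  rw [abs_lt] at h2
  rw [h]
  constructor <;> linarith [Real.pi_pos, h2.1, h2.2]

lemma stableRoot_re_sq_sub (s d : ℝ) :
    (stableRoot s d).re ^ 2 - (stableRoot s d).im ^ 2 = 1 + s ^ 2 := by
  have := congrArg Complex.re (stableRoot_sq s d)
  simp [sq] at this ⊢
  linarith

lemma stableRoot_re_mul_im (s d : ℝ) : (stableRoot s d).re * (stableRoot s d).im = -d := by
  have := congrArg Complex.im (stableRoot_sq s d)
  simp [sq] at this ⊢
  linarith

/-- (Re C)² = 1 + s² + (Im C)². This keeps C ± s in the right half-plane, where the principal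
logarithm below is smooth. -/
lemma abs_lt_stableRoot_re (s d : ℝ) : |s| < (stableRoot s d).re := by
  have h := stableRoot_re_sq_sub s d
  have h0 := stableRoot_re_pos s d
  exact abs_lt_of_sq_lt_sq (by nlinarith [sq_nonneg (stableRoot s d).im]) h0.le

/-- The logarithmic form of the angle; each of its logarithms is of a number with positive real
part. -/
noncomputable def stableLog (s d : ℝ) : ℂ :=
  (Complex.log (stableRoot s d + s + Complex.I) - Complex.log (stableRoot s d + s - Complex.I))
    + (Complex.log (stableRoot s d - s + Complex.I)
      - Complex.log (stableRoot s d - s - Complex.I))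

/-- Both points have real part Re a > 0, so both arguments lie in (-π/2, π/2). Their tangents are
(Im a ± 1)/Re a, which fixes their order. -/
lemma log_add_I_sub_log_sub_I_im {a : ℂ} (ha : 0 < a.re) :
    0 < (Complex.log (a + Complex.I) - Complex.log (a - Complex.I)).im ∧
      (Complex.log (a + Complex.I) - Complex.log (a - Complex.I)).im < Real.pi := by
  have h1 : 0 < (a + Complex.I).re := by simpa using ha
  have h2 : 0 < (a - Complex.I).re := by simpa using ha
  have b1 := abs_lt.1 ((Complex.abs_arg_lt_pi_div_two_iff).2 (Or.inl h1))
  have b2 := abs_lt.1 ((Complex.abs_arg_lt_pi_div_two_iff).2 (Or.inl h2))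
  rw [Complex.sub_im, Complex.log_im, Complex.log_im]
  refine ⟨?_, by linarith⟩
  have e1 := Complex.tan_arg (a + Complex.I)
  have e2 := Complex.tan_arg (a - Complex.I)
  have : Real.tan (Complex.arg (a - Complex.I)) < Real.tan (Complex.arg (a + Complex.I)) := by
    rw [e1, e2]
    simp
    gcongr
    linarith
  by_contra hcon
  have hle : Complex.arg (a + Complex.I) ≤ Complex.arg (a - Complex.I) := by linarith
  have := (Real.strictMonoOn_tan.monotoneOn) (a := Complex.arg (a + Complex.I))
    (b := Complex.arg (a - Complex.I)) ⟨b1.1, b1.2⟩ ⟨b2.1, b2.2⟩ hle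
  linarith

lemma stableLog_im (s d : ℝ) : 0 < (stableLog s d).im ∧ (stableLog s d).im < 2 * Real.pi := by
  have h := abs_lt.1 (abs_lt_stableRoot_re s d)
  have h1 := log_add_I_sub_log_sub_I_im (a := stableRoot s d + s) (by simp; linarith)
  have h2 := log_add_I_sub_log_sub_I_im (a := stableRoot s d - s) (by simp; linarith)
  rw [stableLog, Complex.add_im]
  constructor <;> linarith [h1.1, h1.2, h2.1, h2.2]

/-- If C were the real number -d, then Im C = 0. But Re C · Im C = -d would force d = 0, against (Re
C)² ≥ 1. -/
lemma stableRoot_add_ne_zero (s d : ℝ) : stableRoot s d + d ≠ 0 := by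
  intro h
  have h1 := congrArg Complex.re h
  have h2 := congrArg Complex.im h
  simp at h1 h2
  have h3 := stableRoot_re_sq_sub s d
  have h4 := stableRoot_re_mul_im s d
  rw [h2] at h3 h4
  nlinarith [sq_nonneg s]

lemma stableRoot_sub_ne_zero (s d : ℝ) : (d : ℂ) - stableRoot s d ≠ 0 := by
  intro h
  have h1 := congrArg Complex.re h
  have h2 := congrArg Complex.im h
  simp at h1 h2
  have h3 := stableRoot_re_sq_sub s d
  have h4 := stableRoot_re_mul_im s d
  rw [h2] at h3 h4
  nlinarith [sq_nonneg s]

/-- By C² = Q, the products (C + s ± i)(C - s ± i) collapse to 2i(C - d) and -2i(C + d), in which s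
no longer appears. -/
lemma exp_stableLog (s d : ℝ) :
    Complex.exp (stableLog s d) = (d - stableRoot s d) / (d + stableRoot s d) := by
  have h := abs_lt.1 (abs_lt_stableRoot_re s d)
  have n1 : stableRoot s d + s + Complex.I ≠ 0 := fun h0 => by
    have := congrArg Complex.re h0; simp at this; linarith
  have n2 : stableRoot s d + s - Complex.I ≠ 0 := fun h0 => by
    have := congrArg Complex.re h0; simp at this; linarith
  have n3 : stableRoot s d - s + Complex.I ≠ 0 := fun h0 => by
    have := congrArg Complex.re h0; simp at this; linarith
  have n4 : stableRoot s d - s - Complex.I ≠ 0 := fun h0 => by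
    have := congrArg Complex.re h0; simp at this; linarith
  have n5 : (d : ℂ) + stableRoot s d ≠ 0 := by rw [add_comm]; exact stableRoot_add_ne_zero s d
  rw [stableLog, Complex.exp_add, Complex.exp_sub, Complex.exp_sub, Complex.exp_log n1,
    Complex.exp_log n2, Complex.exp_log n3, Complex.exp_log n4]
  have e := stableRoot_sq s d
  rw [stableQ_eq] at e
  field_simp
  generalize stableRoot s d = c at *
  have e1 : (c + s + Complex.I) * (c - s + Complex.I) = 2 * Complex.I * (c - d) := by
    have : (c + s + Complex.I) * (c - s + Complex.I)
      = c ^ 2 - s ^ 2 + Complex.I ^ 2 + 2 * Complex.I * c := by ring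
    rw [this, e, Complex.I_sq]; ring
  have e2 : (c + s - Complex.I) * (c - s - Complex.I) = - 2 * Complex.I * (d + c) := by
    have : (c + s - Complex.I) * (c - s - Complex.I)
      = c ^ 2 - s ^ 2 + Complex.I ^ 2 - 2 * Complex.I * c := by ring
    rw [this, e, Complex.I_sq]; ring
  linear_combination (d + c) * e1 - (d - c) * e2

/-- The numerator of the imaginary part is -2d Im C, and Re C · Im C = -d with Re C > 0 makes d · Im
C negative. -/
lemma div_im_pos_of_stableRoot {s d : ℝ} (hd : d ≠ 0) :
    0 < (((d : ℂ) - stableRoot s d) / (d + stableRoot s d)).im := by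
  have h4 := stableRoot_re_mul_im s d
  have h0 := stableRoot_re_pos s d
  have n5 : (d : ℂ) + stableRoot s d ≠ 0 := by rw [add_comm]; exact stableRoot_add_ne_zero s d
  rw [Complex.div_im, ← sub_div]
  refine div_pos ?_ (Complex.normSq_pos.2 n5)
  simp
  have : d * (stableRoot s d).im < 0 := by
    have h5 : 0 < d ^ 2 := by positivity
    by_contra hcon
    push Not at hcon
    have h6 : (stableRoot s d).re * (d * (stableRoot s d).im) = -d ^ 2 := by
      linear_combination d * h4
    nlinarith [mul_nonneg h0.le hcon]
  nlinarith

/-- Both sides have the same exponential after multiplication by 2i, so they differ by 2πi n. One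
imaginary part lies in (0, 2π) and the other in (0, π], hence n = 0. This gives a single formula
across d = 0 and all branch cuts. -/
lemma stableAngle_eq (s d : ℝ) : stableAngle s d = stableLog s d / (2 * Complex.I) := by
  have hI := stableLog_im s d
  have hexp := exp_stableLog s d
  have key : stableLog s d = 2 * Complex.I * stableAngle s d := by
    by_cases hd : d = 0
    -- At d = 0 the quotient (d - C)/(d + C) is -1, matching the value π/2 assigned to the angle.
    · have e : Complex.exp (stableLog s d) = Complex.exp (Real.pi * Complex.I) := by
        rw [hexp, Complex.exp_pi_mul_I, hd]
        have := stableRoot_ne_zero s 0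
        simp [this]
      obtain ⟨n, hn⟩ := Complex.exp_eq_exp_iff_exists_int.1 e
      have him := congrArg Complex.im hn
      simp at him
      rw [him] at hI
      have hn0 : n = 0 := by
        have h1 : (-1 : ℝ) < n := by nlinarith [Real.pi_pos, hI.1]
        have h2 : (n : ℝ) < 1 := by nlinarith [Real.pi_pos, hI.2]
        have h1' : -1 < n := by exact_mod_cast h1
        have h2' : n < 1 := by exact_mod_cast h2
        omega
      rw [stableAngle, if_pos hd, hn, hn0]
      push_cast
      ring
    · have hdC : (d : ℂ) ≠ 0 := by exact_mod_cast hd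
      have n5 : (d : ℂ) + stableRoot s d ≠ 0 := by
        rw [add_comm]; exact stableRoot_add_ne_zero s d
      have hpos := div_im_pos_of_stableRoot (s := s) hd
      have ea : 2 * Complex.I * stableAngle s d
          = Complex.log ((d - stableRoot s d) / (d + stableRoot s d)) := by
        rw [stableAngle, if_neg hd, Complex.arctan]
        have : (1 + Complex.I * stableRoot s d / d * Complex.I)
            / (1 - Complex.I * stableRoot s d / d * Complex.I)
            = (d - stableRoot s d) / (d + stableRoot s d) := by
          have e1 : Complex.I * stableRoot s d / d * Complex.I = - (stableRoot s d / d) := by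
            linear_combination (stableRoot s d / d) * Complex.I_sq
          rw [e1, ← sub_eq_add_neg, sub_neg_eq_add]
          field_simp
        rw [this]
        linear_combination (-Complex.log ((d - stableRoot s d) / (d + stableRoot s d)))
          * Complex.I_sq
      have e : Complex.exp (stableLog s d) = Complex.exp (2 * Complex.I * stableAngle s d) := by
        rw [ea, hexp, Complex.exp_log (div_ne_zero (stableRoot_sub_ne_zero s d) n5)]
      obtain ⟨n, hn⟩ := Complex.exp_eq_exp_iff_exists_int.1 e
      have him := congrArg Complex.im hn
      rw [ea] at him
      simp only [Complex.add_im, Complex.log_im] at him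
      have h2 : ((n : ℂ) * (2 * Real.pi * Complex.I)).im = n * (2 * Real.pi) := by
        simp
      rw [h2] at him
      have a1 : 0 < Complex.arg ((d - stableRoot s d) / (d + stableRoot s d)) := by
        refine lt_of_le_of_ne (Complex.arg_nonneg_iff.2 hpos.le) fun h0 => ?_
        have := (Complex.arg_eq_zero_iff.1 h0.symm).2
        linarith
      have a2 := Complex.arg_le_pi ((d - stableRoot s d) / (d + stableRoot s d))
      have hn0 : n = 0 := by
        have h1 : (-1 : ℝ) < n := by nlinarith [Real.pi_pos, hI.1]
        have h2 : (n : ℝ) < 1 := by nlinarith [Real.pi_pos, hI.2]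
        have h1' : -1 < n := by exact_mod_cast h1
        have h2' : n < 1 := by exact_mod_cast h2
        omega
      rw [hn, hn0]; simp
  rw [key]
  field_simp [Complex.I_ne_zero]

/-- The density in the coordinates `s = x₁`, `d = x₁ - 2 x₂`. -/
noncomputable def stableDensity (s d : ℝ) : ℝ :=
  1 / Real.pi ^ 2 * (4 / Complex.normSq (stableQ s d)
    + 2 * (stableAngle s d / stableRoot s d ^ 3).re)

lemma ciDensity_eq_stableDensity (x : EuclideanSpace ℝ (Fin 2)) :
    ciDensity x = stableDensity (x 0) (x 0 - 2 * x 1) := by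
  have hQ : ciQ x = stableQ (x 0) (x 0 - 2 * x 1) := by
    rw [ciQ, stableQ_eq]; push_cast; ring
  have hns : Complex.normSq (stableQ (x 0) (x 0 - 2 * x 1))
      = 1 + 6 * x 0 ^ 2 + x 0 ^ 4 - 16 * x 0 * x 1 + 16 * x 1 ^ 2 := by
    rw [Complex.normSq_apply]; simp; ring
  rw [ciDensity, stableDensity]
  split_ifs with h
  · have h0 : x 0 - 2 * x 1 = 0 := by linarith
    rw [h0, stableAngle, if_pos rfl]
    have hq : stableQ (x 0) 0 = ((1 + x 0 ^ 2 : ℝ) : ℂ) := by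
      apply Complex.ext <;> simp [sq]
    have hp : (0 : ℝ) < 1 + x 0 ^ 2 := by positivity
    rw [← stableQ_cpow_three_halves, hq, Complex.normSq_ofReal]
    have e : (((1 + x 0 ^ 2 : ℝ) : ℂ) ^ (3 / 2 : ℂ))
        = (((1 + x 0 ^ 2 : ℝ) ^ (3 / 2 : ℝ) : ℝ) : ℂ) := by
      rw [Complex.ofReal_cpow hp.le]; norm_num
    rw [e, ← Complex.ofReal_div, Complex.ofReal_re]
    have h3 : (0 : ℝ) < (1 + x 0 ^ 2) ^ (3 / 2 : ℝ) := Real.rpow_pos_of_pos hp _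
    field_simp
  · have hd : x 0 - 2 * x 1 ≠ 0 := fun h' => h (by linarith)
    rw [hns, hQ, stableAngle, if_neg hd, stableQ_cpow_three_halves, stableRoot]
    ring

/-! ### The envelope inequality -/

lemma norm_arctan_sub_taylor_le {z : ℂ} (hz : ‖z‖ < 1) :
    ‖Complex.arctan z - z + z ^ 3 / 3‖ ≤ ‖z‖ ^ 5 / (5 * (1 - ‖z‖ ^ 2)) := by
  have h := (hasSum_nat_add_iff' 2).2 (Complex.hasSum_arctan hz)
  have e : Complex.arctan z - ∑ i ∈ Finset.range 2, (-1 : ℂ) ^ i * z ^ (2 * i + 1) / ↑(2 * i + 1)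
      = Complex.arctan z - z + z ^ 3 / 3 := by
    simp [Finset.sum_range_succ]
    ring
  rw [e] at h
  have hr : ‖z‖ ^ 2 < 1 := by nlinarith [norm_nonneg z]
  have hg := (hasSum_geometric_of_lt_one (sq_nonneg ‖z‖) hr).mul_left (‖z‖ ^ 5 / 5)
  have := tsum_of_norm_bounded hg (f := fun n : ℕ =>
    (-1 : ℂ) ^ (n + 2) * z ^ (2 * (n + 2) + 1) / ↑(2 * (n + 2) + 1)) ?_
  · rw [h.tsum_eq] at this
    refine this.trans (le_of_eq ?_)
    have : 1 - ‖z‖ ^ 2 ≠ 0 := by linarith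
    field_simp
  · intro n
    rw [norm_div, norm_mul, norm_pow, norm_neg, norm_one, one_pow, one_mul, norm_pow,
      Complex.norm_natCast]
    have e1 : ‖z‖ ^ (2 * (n + 2) + 1) = ‖z‖ ^ 5 * (‖z‖ ^ 2) ^ n := by
      rw [← pow_mul, ← pow_add]; congr 1; ring
    have e2 : ‖z‖ ^ 5 / 5 * (‖z‖ ^ 2) ^ n = ‖z‖ ^ 5 * (‖z‖ ^ 2) ^ n / 5 := by ring
    rw [e1, e2]
    gcongr
    push_cast
    linarith [(n.cast_nonneg : (0 : ℝ) ≤ n)]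

lemma norm_stableRoot_sq (s d : ℝ) : ‖stableRoot s d‖ ^ 2 = ‖stableQ s d‖ := by
  rw [← norm_pow, stableRoot_sq]

lemma normSq_stableQ (s d : ℝ) : Complex.normSq (stableQ s d) = ‖stableRoot s d‖ ^ 4 := by
  rw [Complex.normSq_eq_norm_sq, ← norm_stableRoot_sq, ← pow_mul]

lemma norm_stableRoot_pow_four (s d : ℝ) :
    ‖stableRoot s d‖ ^ 4 = (1 + s ^ 2) ^ 2 + 4 * d ^ 2 := by
  rw [← normSq_stableQ, Complex.normSq_apply]; simp; ring

lemma one_add_sq_le_norm_stableRoot_sq (s d : ℝ) : 1 + s ^ 2 ≤ ‖stableRoot s d‖ ^ 2 := by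
  rw [norm_stableRoot_sq]
  exact (le_abs_self _).trans (Complex.abs_re_le_norm (stableQ s d))

lemma one_le_norm_stableRoot (s d : ℝ) : 1 ≤ ‖stableRoot s d‖ := by
  have := one_add_sq_le_norm_stableRoot_sq s d
  nlinarith [sq_nonneg s, norm_nonneg (stableRoot s d)]

lemma abs_stableAngle_re_le (s d : ℝ) : |(stableAngle s d).re| ≤ Real.pi / 2 := by
  rw [stableAngle]
  split_ifs with h
  · rw [Complex.ofReal_re, abs_of_pos (by positivity)]
  · rw [Complex.arctan]
    set w := (1 + Complex.I * stableRoot s d / d * Complex.I)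
      / (1 - Complex.I * stableRoot s d / d * Complex.I)
    have : (-Complex.I / 2 * Complex.log w).re = Complex.arg w / 2 := by
      rw [← Complex.log_im]
      simp [Complex.mul_re]
      ring
    rw [this, abs_div, abs_two]
    have := Complex.abs_arg_le_pi w
    linarith

/-- -2 Im(angle) = log(‖d - C‖/‖d + C‖). Each norm is at most |d| + c, and their product is ‖d² - Q‖
≥ |Im(d² - Q)| = 2|d|, so neither can be too small. -/
lemma abs_stableAngle_im_le {s d : ℝ} (hd : d ≠ 0) :
    |(stableAngle s d).im| ≤ Real.log ((|d| + ‖stableRoot s d‖) ^ 2 / (2 * |d|)) / 2 := by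
  have him : (stableAngle s d).im = - (stableLog s d).re / 2 := by
    rw [stableAngle_eq]
    have : stableLog s d / (2 * Complex.I) = -Complex.I / 2 * stableLog s d := by
      field_simp
      linear_combination (stableLog s d) * Complex.I_sq
    rw [this]
    simp [Complex.mul_im]
    ring
  have hexp := congrArg norm (exp_stableLog s d)
  rw [Complex.norm_exp, norm_div] at hexp
  have p1 : 0 < ‖(d : ℂ) - stableRoot s d‖ := norm_pos_iff.2 (stableRoot_sub_ne_zero s d)
  have p2 : 0 < ‖(d : ℂ) + stableRoot s d‖ := norm_pos_iff.2 (by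
    rw [add_comm]; exact stableRoot_add_ne_zero s d)
  have b1 : ‖(d : ℂ) - stableRoot s d‖ ≤ |d| + ‖stableRoot s d‖ := by
    refine (norm_sub_le _ _).trans ?_
    simp
  have b2 : ‖(d : ℂ) + stableRoot s d‖ ≤ |d| + ‖stableRoot s d‖ := by
    refine (norm_add_le _ _).trans ?_
    simp
  have hprod : 2 * |d| ≤ ‖(d : ℂ) - stableRoot s d‖ * ‖(d : ℂ) + stableRoot s d‖ := by
    rw [← norm_mul]
    have e : ((d : ℂ) - stableRoot s d) * (d + stableRoot s d) = d ^ 2 - stableQ s d := by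
      rw [← stableRoot_sq]; ring
    rw [e]
    refine le_trans (le_of_eq ?_) (Complex.abs_im_le_norm _)
    have : ((d : ℂ) ^ 2 - stableQ s d).im = 2 * d := by
      rw [Complex.sub_im]; simp [sq]
    rw [this, abs_mul, abs_two]
  have hd' : 0 < |d| := abs_pos.2 hd
  have hre : (stableLog s d).re
      = Real.log (‖(d : ℂ) - stableRoot s d‖ / ‖(d : ℂ) + stableRoot s d‖) := by
    rw [← hexp, Real.log_exp]
  have key : ∀ a b K D : ℝ, 0 < a → 0 < b → a ≤ K → 0 < D → D ≤ a * b →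
      Real.log (a / b) ≤ Real.log (K ^ 2 / D) := by
    intro a b K D ha hb haK hD hab
    apply Real.log_le_log (by positivity)
    rw [div_le_div_iff₀ hb hD]
    calc a * D ≤ a * (a * b) := by gcongr
      _ = a ^ 2 * b := by ring
      _ ≤ K ^ 2 * b := by gcongr
  have k1 := key _ _ _ (2 * |d|) p1 p2 b1 (by positivity) hprod
  have k2 := key _ _ _ (2 * |d|) p2 p1 b2 (by positivity) (by linarith)
  rw [← hre] at k1
  rw [← inv_div, Real.log_inv, ← hre] at k2
  rw [him, abs_div, abs_neg, abs_two]
  have := abs_le.2 ⟨by linarith, k1⟩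
  linarith

lemma log_le_div_exp_one {t : ℝ} (ht : 0 < t) : Real.log t ≤ t / Real.exp 1 := by
  have h := Real.log_le_sub_one_of_pos (x := t / Real.exp 1) (by positivity)
  rw [Real.log_div ht.ne' (Real.exp_pos 1).ne', Real.log_exp] at h
  linarith

/-- Im C³ contains the factor Im C, and |Im C| · Re C = |d|. The factor |d| will absorb the
logarithm in the bound for the angle. -/
lemma abs_stableRoot_cube_im_le (s d : ℝ) :
    |((stableRoot s d) ^ 3).im| ≤ 3 * ‖stableRoot s d‖ * |d| := by
  have h1 := stableRoot_re_mul_im s d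
  have h2 := stableRoot_re_sq_sub s d
  have h3 := stableRoot_re_pos s d
  have e : ((stableRoot s d) ^ 3).im
      = (stableRoot s d).im * (3 * (stableRoot s d).re ^ 2 - (stableRoot s d).im ^ 2) := by
    simp [pow_succ]; ring
  have hd : |d| = (stableRoot s d).re * |(stableRoot s d).im| := by
    rw [← abs_neg d, ← h1, abs_mul, abs_of_pos h3]
  have hn : (stableRoot s d).re ≤ ‖stableRoot s d‖ := Complex.re_le_norm _
  rw [e, abs_mul, hd, abs_of_nonneg (a := 3 * _ - _) (by nlinarith [sq_nonneg s])]
  have h4 : 0 ≤ |(stableRoot s d).im| := abs_nonneg _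
  calc |(stableRoot s d).im| * (3 * (stableRoot s d).re ^ 2 - (stableRoot s d).im ^ 2)
      ≤ |(stableRoot s d).im| * (3 * (stableRoot s d).re * (stableRoot s d).re) := by
        gcongr
        nlinarith [sq_nonneg (stableRoot s d).im]
    _ ≤ |(stableRoot s d).im| * (3 * ‖stableRoot s d‖ * (stableRoot s d).re) := by gcongr
    _ = _ := by ring

/-- Here z = iC/d satisfies ‖z‖² ≤ 0.95 and the arctangent series applies. Divided by C³, the linear
term is i/(Qd), with real part -2/|Q|², which cancels 4/|Q|². The cubic term is imaginary. Only the
remainder E counts. -/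
lemma abs_stableDensity_bracket_le_of_far {s d : ℝ} (h : ‖stableRoot s d‖ ^ 2 ≤ 0.95 * d ^ 2) :
    |4 / Complex.normSq (stableQ s d) + 2 * (stableAngle s d / stableRoot s d ^ 3).re|
      ≤ 7.6 / |d| ^ 3 := by
  have hc := one_le_norm_stableRoot s d
  have hd : d ≠ 0 := by
    rintro rfl
    nlinarith
  have hd' : 0 < |d| := abs_pos.2 hd
  have hdC : (d : ℂ) ≠ 0 := by exact_mod_cast hd
  have hC := stableRoot_ne_zero s d
  have hQ := stableQ_ne_zero s d
  set z := Complex.I * stableRoot s d / d with hz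
  have hzn : ‖z‖ = ‖stableRoot s d‖ / |d| := by
    rw [hz, norm_div, norm_mul, Complex.norm_I, one_mul, Complex.norm_real, Real.norm_eq_abs]
  have hz2 : ‖z‖ ^ 2 ≤ 0.95 := by
    rw [hzn, div_pow, div_le_iff₀ (by positivity), sq_abs]; exact h
  have hz1 : ‖z‖ < 1 := by nlinarith [norm_nonneg z]
  have hA : stableAngle s d = Complex.arctan z := by rw [stableAngle, if_neg hd]
  have hb := norm_arctan_sub_taylor_le hz1
  set E := Complex.arctan z - z + z ^ 3 / 3 with hE
  have hN : 0 < Complex.normSq (stableQ s d) := Complex.normSq_pos.2 hQ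
  have e0 : stableAngle s d / stableRoot s d ^ 3
      = E / stableRoot s d ^ 3 + Complex.I / (stableQ s d * d) + Complex.I / (3 * d ^ 3) := by
    rw [hA, hE, ← stableRoot_sq, hz]
    field_simp
    ring_nf
    have : Complex.I ^ 3 = - Complex.I := Complex.I_pow_three
    rw [this]; ring
  have e1 : (Complex.I / (stableQ s d * d)).re = -2 / Complex.normSq (stableQ s d) := by
    rw [← div_div, Complex.div_ofReal_re, Complex.div_re]
    simp
    field_simp
  have e2 : (Complex.I / (3 * (d : ℂ) ^ 3)).re = 0 := by
    have : (Complex.I / (3 * (d : ℂ) ^ 3)) = Complex.I / ((3 * d ^ 3 : ℝ) : ℂ) := by push_cast; rfl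
    rw [this, Complex.div_ofReal_re]; simp
  have e3 : 4 / Complex.normSq (stableQ s d) + 2 * (stableAngle s d / stableRoot s d ^ 3).re
      = 2 * (E / stableRoot s d ^ 3).re := by
    rw [e0, Complex.add_re, Complex.add_re, e1, e2]; ring
  rw [e3, abs_mul, abs_two]
  have h5 : |(E / stableRoot s d ^ 3).re| ≤ ‖E‖ / ‖stableRoot s d‖ ^ 3 := by
    refine (Complex.abs_re_le_norm _).trans ?_
    rw [norm_div, norm_pow]
  have h6 : ‖E‖ / ‖stableRoot s d‖ ^ 3 ≤ 3.8 / |d| ^ 3 := by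
    -- 0.25 = 5(1 - 0.95); then 0.95/0.25 = 3.8, and 7.6 = 2 · 3.8.
    have hb' : ‖E‖ ≤ ‖z‖ ^ 5 / 0.25 := by
      refine hb.trans ?_
      gcongr
      linarith
    have h7 : ‖z‖ ^ 5 ≤ 0.95 * ‖z‖ ^ 3 := by nlinarith [pow_nonneg (norm_nonneg z) 3]
    have h8 : ‖E‖ ≤ 3.8 * ‖z‖ ^ 3 := by
      refine hb'.trans ?_
      rw [div_le_iff₀ (by norm_num)]
      linarith
    rw [div_le_iff₀ (by positivity)]
    refine h8.trans (le_of_eq ?_)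
    rw [hzn]; field_simp
  calc 2 * |(E / stableRoot s d ^ 3).re| ≤ 2 * (3.8 / |d| ^ 3) := by linarith
    _ = 7.6 / |d| ^ 3 := by ring

/-- With |d| at most a multiple of c, real and imaginary parts of angle / C³ are bounded separately.
The constants are 1.575 > π/2 for the real part, 1.14 for the product of imaginary parts, and 5.43 =
2(1.575 + 1.14). -/
lemma abs_stableDensity_bracket_le_of_near {s d : ℝ} (h : 0.95 * d ^ 2 ≤ ‖stableRoot s d‖ ^ 2) :
    |4 / Complex.normSq (stableQ s d) + 2 * (stableAngle s d / stableRoot s d ^ 3).re|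
      ≤ (4 / ‖stableRoot s d‖ + 5.43) / ‖stableRoot s d‖ ^ 3 := by
  have hc := one_le_norm_stableRoot s d
  have hre := abs_stableAngle_re_le s d
  have hcube := abs_stableRoot_cube_im_le s d
  have hcr : |((stableRoot s d) ^ 3).re| ≤ ‖stableRoot s d‖ ^ 3 := by
    rw [← norm_pow]; exact Complex.abs_re_le_norm _
  have him : |(stableAngle s d).im| * |((stableRoot s d) ^ 3).im| ≤ 1.14 * ‖stableRoot s d‖ ^ 3 := by
    by_cases hd : d = 0
    · have : (stableAngle s d).im = 0 := by rw [stableAngle, if_pos hd, Complex.ofReal_im]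
      rw [this, abs_zero, zero_mul]
      positivity
    · have h1 := abs_stableAngle_im_le (s := s) hd
      have hd' : 0 < |d| := abs_pos.2 hd
      set c := ‖stableRoot s d‖
      have h2 := log_le_div_exp_one (t := (|d| + c) ^ 2 / (2 * |d|)) (by positivity)
      -- 1.027² > 1/0.95; below, 4.11 > 2.027².
      have hdc : |d| ≤ 1.027 * c := by
        refine abs_le_of_sq_le_sq' ?_ (by positivity) |> abs_le.2
        nlinarith
      have h3 : (|d| + c) ^ 2 ≤ 4.11 * c ^ 2 := by
        have : |d| + c ≤ 2.027 * c := by linarith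
        calc (|d| + c) ^ 2 ≤ (2.027 * c) ^ 2 := by gcongr
          _ ≤ _ := by nlinarith
      have he : 2.718 < Real.exp 1 := by linarith [Real.exp_one_gt_d9]
      have h4 : (|d| + c) ^ 2 / (2 * |d|) / Real.exp 1 ≤ 4.11 * c ^ 2 / (2 * |d|) / 2.718 := by
        gcongr
      calc |(stableAngle s d).im| * |((stableRoot s d) ^ 3).im|
          ≤ (4.11 * c ^ 2 / (2 * |d|) / 2.718 / 2) * (3 * c * |d|) := by
            gcongr
            linarith
        _ = 4.11 * 3 / 4 / 2.718 * c ^ 3 := by field_simp; norm_num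
        _ ≤ 1.14 * c ^ 3 := by gcongr; norm_num
  have e : (stableAngle s d / stableRoot s d ^ 3).re
      = ((stableAngle s d).re * ((stableRoot s d) ^ 3).re
        + (stableAngle s d).im * ((stableRoot s d) ^ 3).im) / ‖stableRoot s d‖ ^ 6 := by
    rw [Complex.div_re, Complex.normSq_eq_norm_sq, norm_pow, ← pow_mul, ← add_div]
  have h5 : |(stableAngle s d).re * ((stableRoot s d) ^ 3).re
        + (stableAngle s d).im * ((stableRoot s d) ^ 3).im| ≤ 2.715 * ‖stableRoot s d‖ ^ 3 := by
    refine (abs_add_le _ _).trans ?_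
    rw [abs_mul, abs_mul]
    have : |(stableAngle s d).re| * |((stableRoot s d) ^ 3).re|
        ≤ 1.575 * ‖stableRoot s d‖ ^ 3 := by
      gcongr
      linarith [Real.pi_lt_d2]
    linarith
  rw [normSq_stableQ, e]
  set c := ‖stableRoot s d‖
  refine (abs_add_le _ _).trans ?_
  rw [abs_mul, abs_div, abs_div, abs_two, abs_of_pos (by positivity : (0 : ℝ) < 4),
    abs_of_pos (by positivity : (0 : ℝ) < c ^ 4), abs_of_pos (by positivity : (0 : ℝ) < c ^ 6)]
  calc 4 / c ^ 4 + 2 * (|(stableAngle s d).re * ((stableRoot s d) ^ 3).re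
        + (stableAngle s d).im * ((stableRoot s d) ^ 3).im| / c ^ 6)
      ≤ 4 / c ^ 4 + 2 * (2.715 * c ^ 3 / c ^ 6) := by gcongr
    _ = (4 / c + 5.43) / c ^ 3 := by field_simp; ring

/-- Since 1 + s² ≤ c², one has ρ² ≤ c² + d², which settles the far case. In the near case this only
gives ρ ≤ 1.433 c, which suffices once 4/c is small. For c ≤ 1.4 the identity 4d² = c⁴ - (1 + s²)²
gives a sharper bound on ρ/c. -/
lemma abs_stableDensity_bracket_mul_le (s d ρ : ℝ) (hρ : 0 ≤ ρ) (hρ2 : ρ ^ 2 = 1 + s ^ 2 + d ^ 2) :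
    |4 / Complex.normSq (stableQ s d) + 2 * (stableAngle s d / stableRoot s d ^ 3).re| * ρ ^ 3
      ≤ 25 := by
  have hc := one_le_norm_stableRoot s d
  have hA := one_add_sq_le_norm_stableRoot_sq s d
  have h4 := norm_stableRoot_pow_four s d
  rcases le_total (‖stableRoot s d‖ ^ 2) (0.95 * d ^ 2) with h | h
  · have hb := abs_stableDensity_bracket_le_of_far h
    have hd' : 0 < |d| := by
      rw [abs_pos]; rintro rfl; nlinarith
    have hr : ρ ≤ 1.4 * |d| := by
      refine abs_le_of_sq_le_sq' ?_ (by positivity) |>.2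
      rw [mul_pow, sq_abs]
      nlinarith
    calc _ ≤ 7.6 / |d| ^ 3 * (1.4 * |d|) ^ 3 := by gcongr
      _ = 7.6 * 1.4 ^ 3 := by field_simp
      _ ≤ 25 := by norm_num
  · have hb := abs_stableDensity_bracket_le_of_near h
    generalize ‖stableRoot s d‖ = c at *
    have hc0 : 0 < c := by linarith
    rcases le_total c 1.4 with h1 | h1
    · have hr : ρ ≤ 1.25 * c := by
        refine abs_le_of_sq_le_sq' ?_ (by positivity) |>.2
        nlinarith [sq_nonneg s, mul_nonneg (sq_nonneg c) (by nlinarith : 0 ≤ 1.96 - c ^ 2)]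
      have h2 : 4 / c ≤ 4 := by rw [div_le_iff₀ hc0]; linarith
      calc _ ≤ (4 / c + 5.43) / c ^ 3 * (1.25 * c) ^ 3 := by gcongr
        _ = (4 / c + 5.43) * 1.25 ^ 3 := by field_simp
        _ ≤ (4 + 5.43) * 1.25 ^ 3 := by gcongr
        _ ≤ 25 := by norm_num
    · have hr : ρ ≤ 1.433 * c := by
        refine abs_le_of_sq_le_sq' ?_ (by positivity) |>.2
        nlinarith
      have h2 : 4 / c ≤ 4 / 1.4 := by gcongr
      calc _ ≤ (4 / c + 5.43) / c ^ 3 * (1.433 * c) ^ 3 := by gcongr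
        _ = (4 / c + 5.43) * 1.433 ^ 3 := by field_simp
        _ ≤ (4 / 1.4 + 5.43) * 1.433 ^ 3 := by gcongr
        _ ≤ 25 := by norm_num

/-- The absolute value matters: it yields integrability of the closed form before its sign is known.
-/
lemma abs_ciDensity_le (x : EuclideanSpace ℝ (Fin 2)) :
    |ciDensity x| ≤ 25 / Real.pi * studentDensity x := by
  have hp : 0 < 1 + x 0 ^ 2 + (x 0 - 2 * x 1) ^ 2 := by positivity
  have hρ : 0 < √(1 + x 0 ^ 2 + (x 0 - 2 * x 1) ^ 2) := Real.sqrt_pos.2 hp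
  have h := abs_stableDensity_bracket_mul_le (x 0) (x 0 - 2 * x 1) _ hρ.le (Real.sq_sqrt hp.le)
  have e : (1 + x 0 ^ 2 + (2 * x 1 - x 0) ^ 2) ^ (-(3 / 2) : ℝ)
      = 1 / √(1 + x 0 ^ 2 + (x 0 - 2 * x 1) ^ 2) ^ 3 := by
    have : (2 * x 1 - x 0) ^ 2 = (x 0 - 2 * x 1) ^ 2 := by ring
    rw [this, Real.rpow_neg hp.le, Real.sqrt_eq_rpow, ← Real.rpow_mul_natCast hp.le]
    norm_num
  rw [ciDensity_eq_stableDensity, studentDensity, e, stableDensity, abs_mul, abs_of_pos (by positivity)]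
  rw [← le_div_iff₀ (by positivity)] at h
  calc _ ≤ 1 / Real.pi ^ 2 * (25 / √(1 + x 0 ^ 2 + (x 0 - 2 * x 1) ^ 2) ^ 3) := by gcongr
    _ = _ := by field_simp

/-! ### One-dimensional integrals -/

/-- The function `t ↦ ∫₀¹ |t + 1 - 2 x| dx`. -/
noncomputable def huber (t : ℝ) : ℝ := if |t| ≤ 1 then (1 + t ^ 2) / 2 else |t|

lemma measurable_huber : Measurable huber :=
  Measurable.ite (measurableSet_le (by fun_prop) measurable_const) (by fun_prop) (by fun_prop)

lemma abs_le_huber (t : ℝ) : |t| ≤ huber t := by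
  rw [huber]
  split_ifs
  · nlinarith [sq_abs t, sq_nonneg (|t| - 1)]
  · rfl

lemma half_le_huber (t : ℝ) : 1 / 2 ≤ huber t := by
  rw [huber]
  split_ifs
  · nlinarith [sq_nonneg t]
  · linarith

lemma huber_pos (t : ℝ) : 0 < huber t := lt_of_lt_of_le (by norm_num) (half_le_huber t)

/-- Both |t| and 1/2 are below `huber t`, so 8 `huber t`² ≥ 1 + t². -/
lemma one_div_huber_sq_le (t : ℝ) : 1 / huber t ^ 2 ≤ 8 * (1 + t ^ 2)⁻¹ := by
  rw [← div_eq_mul_inv, div_le_div_iff₀ (pow_pos (huber_pos t) 2) (by positivity)]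
  have h1 := abs_le_huber t
  have h2 := half_le_huber t
  have h3 : t ^ 2 ≤ huber t ^ 2 := by rw [← sq_abs]; gcongr
  nlinarith

lemma integrable_one_div_huber_sq : Integrable (fun t => 1 / huber t ^ 2) := by
  refine (integrable_inv_one_add_sq.const_mul 8).mono'
    ((measurable_const.div (measurable_huber.pow_const 2)).aestronglyMeasurable) (ae_of_all _ fun t => ?_)
  rw [Real.norm_eq_abs, abs_of_pos (div_pos one_pos (pow_pos (huber_pos t) 2))]
  exact one_div_huber_sq_le t

/-- The zero (t + 1)/2 of the integrand lies in [0, 1] exactly when |t| ≤ 1; otherwise the sign is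
constant. -/
lemma integral_abs_affine (t : ℝ) : ∫ x in (0 : ℝ)..1, |t + 1 - 2 * x| = huber t := by
  have hlin : ∀ a b : ℝ, ∫ x in a..b, (t + 1 - 2 * x) = (t + 1) * (b - a) - (b ^ 2 - a ^ 2) := by
    intro a b
    rw [intervalIntegral.integral_sub (by simp) (by apply Continuous.intervalIntegrable; fun_prop),
      intervalIntegral.integral_const_mul, integral_id]
    simp
    ring
  have hpos : ∀ a b : ℝ, a ≤ b → 2 * b ≤ t + 1 →
      ∫ x in a..b, |t + 1 - 2 * x| = (t + 1) * (b - a) - (b ^ 2 - a ^ 2) := by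
    intro a b hab hb
    rw [← hlin]
    refine intervalIntegral.integral_congr fun x hx => ?_
    rw [Set.uIcc_of_le hab] at hx
    exact abs_of_nonneg (by linarith [hx.2])
  have hneg : ∀ a b : ℝ, a ≤ b → t + 1 ≤ 2 * a →
      ∫ x in a..b, |t + 1 - 2 * x| = -((t + 1) * (b - a) - (b ^ 2 - a ^ 2)) := by
    intro a b hab ha
    rw [← hlin, ← intervalIntegral.integral_neg]
    refine intervalIntegral.integral_congr fun x hx => ?_
    rw [Set.uIcc_of_le hab] at hx
    exact abs_of_nonpos (by linarith [hx.1])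
  have hint : ∀ a b : ℝ, IntervalIntegrable (fun x => |t + 1 - 2 * x|) volume a b :=
    fun a b => (by fun_prop : Continuous fun x => |t + 1 - 2 * x|).intervalIntegrable _ _
  rw [huber]
  split_ifs with h
  · rw [abs_le] at h
    rw [← intervalIntegral.integral_add_adjacent_intervals (hint 0 ((t + 1) / 2)) (hint _ 1),
      hpos _ _ (by linarith) (by linarith), hneg _ _ (by linarith) (by linarith)]
    ring
  · rw [not_le, lt_abs] at h
    rcases h with h | h
    · rw [hpos _ _ zero_le_one (by linarith), abs_of_pos (by linarith)]; ring
    · rw [hneg _ _ zero_le_one (by linarith), abs_of_neg (by linarith)]; ring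

lemma integral_Ioi_one_div_affine_sq {a b : ℂ} (ha : a ≠ 0) (hne : ∀ t : ℝ, 1 ≤ t → a * t + b ≠ 0)
    (hint : IntegrableOn (fun t : ℝ => 1 / (a * t + b) ^ 2) (Set.Ioi 1)) :
    ∫ t in Set.Ioi (1 : ℝ), 1 / (a * t + b) ^ 2 = 1 / (a * (a + b)) := by
  have hderiv : ∀ t : ℝ, 1 ≤ t →
      HasDerivAt (fun t : ℝ => - (1 / a) * (a * t + b)⁻¹) (1 / (a * t + b) ^ 2) t := by
    intro t ht
    have h1 : HasDerivAt (fun t : ℝ => a * (t : ℂ) + b) a t := by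
      simpa using ((Complex.ofRealCLM.hasDerivAt (x := t)).const_mul a).add_const b
    have h2 := (h1.fun_inv (hne t ht)).const_mul (-(1 / a))
    refine h2.congr_deriv ?_
    have := hne t ht
    field_simp
  have htend : Tendsto (fun t : ℝ => - (1 / a) * (a * t + b)⁻¹) atTop (𝓝 0) := by
    rw [show (0 : ℂ) = - (1 / a) * 0 by simp]
    refine Tendsto.const_mul _ (tendsto_inv₀_cobounded.comp ?_)
    rw [← tendsto_norm_atTop_iff_cobounded]
    have h : Tendsto (fun t : ℝ => ‖a‖ * t - ‖b‖) atTop atTop :=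
      tendsto_atTop_add_const_right _ _ (tendsto_id.const_mul_atTop (norm_pos_iff.2 ha))
    refine tendsto_atTop_mono' _ ?_ h
    filter_upwards [eventually_ge_atTop 0] with t ht
    have := norm_sub_norm_le (a * (t : ℂ)) (-b)
    rw [sub_neg_eq_add, norm_neg, norm_mul, Complex.norm_real, Real.norm_eq_abs,
      abs_of_nonneg ht] at this
    exact this
  have h := integral_Ioi_of_hasDerivAt_of_tendsto
    (f := fun t : ℝ => - (1 / a) * (a * t + b)⁻¹) (a := 1)
    ((hderiv 1 le_rfl).continuousAt.continuousWithinAt)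
    (fun t ht => hderiv t (le_of_lt ht)) hint htend
  rw [h]
  have h1 := hne 1 le_rfl
  simp at h1 ⊢
  ring

/-! ### The integral over directions, in closed form. -/

/-- Completing the square: for |t| ≤ 1 the right side is 2(`huber t` - i(s t + d)), so Q appears as
a discriminant. -/
lemma quadratic_eq (s d t : ℝ) :
    ((t : ℂ) - Complex.I * s) ^ 2 + stableQ s d
      = ((1 + t ^ 2 : ℝ) : ℂ) - 2 * Complex.I * (s * t + d) := by
  rw [stableQ_eq]
  push_cast
  linear_combination (s : ℂ) ^ 2 * Complex.I_sq

lemma quadratic_ne_zero (s d t : ℝ) : ((t : ℂ) - Complex.I * s) ^ 2 + stableQ s d ≠ 0 := by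
  rw [quadratic_eq]
  intro h
  have := congrArg Complex.re h
  have e : (2 * Complex.I * ((s : ℂ) * t + d)).re = 0 := by
    rw [← Complex.ofReal_mul, ← Complex.ofReal_add]; simp
  rw [Complex.sub_re, e, Complex.ofReal_re, Complex.zero_re] at this
  nlinarith [sq_nonneg t]

/-- With τ = t - is, the standard primitive of 4/(τ² + C²)² is a rational term plus an arctangent.
The latter is written with log(C + s + it) - log(C - s - it), whose arguments stay in the right
half-plane because |s| < Re C. -/
lemma integral_one_div_quadratic_sq (s d : ℝ) :
    ∫ t in (-1 : ℝ)..1, 4 / (((t : ℂ) - Complex.I * s) ^ 2 + stableQ s d) ^ 2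
      = 2 * stableAngle s d / stableRoot s d ^ 3
        + (1 - Complex.I * s) / (stableQ s d * (1 - Complex.I * s - Complex.I * d))
        + (1 + Complex.I * s) / (stableQ s d * (1 + Complex.I * s - Complex.I * d)) := by
  have hC := stableRoot_ne_zero s d
  have hQ := stableQ_ne_zero s d
  have hre := abs_lt.1 (abs_lt_stableRoot_re s d)
  set C := stableRoot s d with hCdef
  have hC2 : C ^ 2 = stableQ s d := stableRoot_sq s d
  have hderiv : ∀ t : ℝ, HasDerivAt (fun t : ℝ =>
      2 * ((t : ℂ) - Complex.I * s) / (stableQ s d * (((t : ℂ) - Complex.I * s) ^ 2 + stableQ s d))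
      + 1 / (Complex.I * C ^ 3) * (Complex.log (C + s + t * Complex.I)
        - Complex.log (C - s - t * Complex.I)))
      (4 / (((t : ℂ) - Complex.I * s) ^ 2 + stableQ s d) ^ 2) t := by
    intro t
    have h0 : HasDerivAt (fun t : ℝ => (t : ℂ)) 1 t := Complex.ofRealCLM.hasDerivAt
    have h1 : HasDerivAt (fun t : ℝ => (t : ℂ) - Complex.I * s) 1 t := h0.sub_const _
    have hq := quadratic_ne_zero s d t
    have h2 : HasDerivAt (fun t : ℝ => stableQ s d * (((t : ℂ) - Complex.I * s) ^ 2 + stableQ s d))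
        (stableQ s d * (2 * ((t : ℂ) - Complex.I * s))) t := by
      simpa using ((h1.fun_pow 2).add_const (stableQ s d)).const_mul (stableQ s d)
    have h3 := (h1.const_mul 2).fun_div h2 (mul_ne_zero hQ hq)
    have s1 : C + s + t * Complex.I ∈ Complex.slitPlane := Or.inl (by simp; linarith)
    have s2 : C - s - t * Complex.I ∈ Complex.slitPlane := Or.inl (by simp; linarith)
    have h4 : HasDerivAt (fun t : ℝ => C + s + t * Complex.I) Complex.I t := by
      simpa using (h0.mul_const Complex.I).const_add (C + s)
    have h5 : HasDerivAt (fun t : ℝ => C - s - t * Complex.I) (-Complex.I) t := by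
      simpa using (h0.mul_const Complex.I).const_sub (C - s)
    have h6 := ((h4.clog_real s1).sub (h5.clog_real s2)).const_mul (1 / (Complex.I * C ^ 3))
    refine (h3.add h6).congr_deriv ?_
    have n1 := Complex.slitPlane_ne_zero s1
    have n2 := Complex.slitPlane_ne_zero s2
    have hprod : (C + s + t * Complex.I) * (C - s - t * Complex.I)
        = ((t : ℂ) - Complex.I * s) ^ 2 + stableQ s d := by
      rw [← hC2]
      linear_combination (- (s : ℂ) ^ 2 - (t : ℂ) ^ 2) * Complex.I_sq
    have hsum : Complex.I / (C + s + t * Complex.I) - -Complex.I / (C - s - t * Complex.I)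
        = 2 * Complex.I * C / (((t : ℂ) - Complex.I * s) ^ 2 + stableQ s d) := by
      rw [← hprod, neg_div, sub_neg_eq_add, div_add_div _ _ n1 n2]
      congr 1
      ring
    rw [hsum]
    generalize (t : ℂ) - Complex.I * s = τ at *
    rw [← hC2] at hq ⊢
    have hI := Complex.I_ne_zero
    field_simp
    ring
  have hcont : Continuous fun t : ℝ =>
      4 / (((t : ℂ) - Complex.I * s) ^ 2 + stableQ s d) ^ 2 := by
    refine continuous_const.div (by fun_prop) fun t => pow_ne_zero 2 (quadratic_ne_zero s d t)
  rw [intervalIntegral.integral_eq_sub_of_hasDerivAt (fun t _ => hderiv t)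
    (hcont.intervalIntegrable _ _)]
  have hL : stableAngle s d = stableLog s d / (2 * Complex.I) := stableAngle_eq s d
  have e1 : (((1 : ℝ) : ℂ) - Complex.I * s) ^ 2 + stableQ s d
      = 2 * (1 - Complex.I * s - Complex.I * d) := by
    rw [quadratic_eq]; push_cast; ring
  have e2 : (((-1 : ℝ) : ℂ) - Complex.I * s) ^ 2 + stableQ s d
      = 2 * (1 + Complex.I * s - Complex.I * d) := by
    rw [quadratic_eq]; push_cast; ring
  have n1 := quadratic_ne_zero s d 1
  have n2 := quadratic_ne_zero s d (-1)
  rw [e1] at n1 ⊢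
  rw [e2] at n2 ⊢
  rw [hL, stableLog, ← hCdef]
  have m1 : (1 - Complex.I * s - Complex.I * d : ℂ) ≠ 0 := fun h => n1 (by rw [h, mul_zero])
  have m2 : (1 + Complex.I * s - Complex.I * d : ℂ) ≠ 0 := fun h => n2 (by rw [h, mul_zero])
  have a1 : C + s + ((-1 : ℝ) : ℂ) * Complex.I = C + s - Complex.I := by push_cast; ring
  have a2 : C - s - ((-1 : ℝ) : ℂ) * Complex.I = C - s + Complex.I := by push_cast; ring
  rw [a1, a2]
  push_cast
  rw [one_mul]
  have hI := Complex.I_ne_zero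
  field_simp
  ring

/-- The inverse square of the homogeneous exponent, on the line of directions. -/
noncomputable def dirKernel (s d t : ℝ) : ℂ :=
  1 / ((huber t : ℂ) - Complex.I * (s * t + d)) ^ 2

lemma norm_dirKernel_le (s d t : ℝ) : ‖dirKernel s d t‖ ≤ 1 / huber t ^ 2 := by
  rw [dirKernel, norm_div, norm_one, norm_pow]
  have h := huber_pos t
  gcongr
  refine le_trans (le_of_eq ?_) (Complex.abs_re_le_norm _)
  rw [Complex.sub_re, ← Complex.ofReal_mul, ← Complex.ofReal_add]
  simp [abs_of_pos h]

lemma measurable_dirKernel (s d : ℝ) : Measurable (dirKernel s d) := by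
  have := measurable_huber
  unfold dirKernel
  fun_prop

lemma integrable_dirKernel (s d : ℝ) : Integrable (dirKernel s d) :=
  integrable_one_div_huber_sq.mono' (measurable_dirKernel s d).aestronglyMeasurable
    (ae_of_all _ fun t => norm_dirKernel_le s d t)

lemma one_sub_I_mul_ne_zero (s : ℝ) : (1 - Complex.I * s : ℂ) ≠ 0 := fun h => by
  have := congrArg Complex.re h; simp at this

lemma one_add_I_mul_ne_zero (s : ℝ) : (1 + Complex.I * s : ℂ) ≠ 0 := fun h => by
  have := congrArg Complex.re h; simp at this

lemma integral_dirKernel_Ioi (s d : ℝ) :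
    ∫ t in Set.Ioi (1 : ℝ), dirKernel s d t
      = 1 / ((1 - Complex.I * s) * (1 - Complex.I * s - Complex.I * d)) := by
  have e : ∀ t : ℝ, t ∈ Set.Ioi (1 : ℝ) →
      dirKernel s d t = 1 / ((1 - Complex.I * s) * t + (-Complex.I * d)) ^ 2 := by
    intro t ht
    have h1 : (1 : ℝ) < t := ht
    have : huber t = t := by
      rw [huber, abs_of_pos (by linarith), if_neg (by linarith)]
    rw [dirKernel, this]
    congr 2
    ring
  rw [setIntegral_congr_fun measurableSet_Ioi e, integral_Ioi_one_div_affine_sq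
    (one_sub_I_mul_ne_zero s) ?_ ?_]
  · congr 2; ring
  · intro t ht h
    have := congrArg Complex.re h
    simp at this
    linarith
  · exact (integrable_dirKernel s d).integrableOn.congr_fun e measurableSet_Ioi

lemma integral_dirKernel_Iic (s d : ℝ) :
    ∫ t in Set.Iic (-1 : ℝ), dirKernel s d t
      = 1 / ((1 + Complex.I * s) * (1 + Complex.I * s - Complex.I * d)) := by
  have hneg : ∀ t, dirKernel s d (-t) = dirKernel (-s) d t := by
    intro t
    simp [dirKernel, huber]
  rw [← integral_comp_neg_Ioi]
  simp_rw [hneg]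
  rw [integral_dirKernel_Ioi]
  simp

lemma integral_dirKernel_Ioc (s d : ℝ) :
    ∫ t in Set.Ioc (-1 : ℝ) 1, dirKernel s d t
      = ∫ t in (-1 : ℝ)..1, 4 / (((t : ℂ) - Complex.I * s) ^ 2 + stableQ s d) ^ 2 := by
  rw [intervalIntegral.integral_of_le (by norm_num)]
  refine setIntegral_congr_fun measurableSet_Ioc fun t ht => ?_
  have : huber t = (1 + t ^ 2) / 2 := by
    rw [huber, if_pos (abs_le.2 ⟨ht.1.le, ht.2⟩)]
  have hq := quadratic_ne_zero s d t
  rw [quadratic_eq] at hq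
  rw [quadratic_eq, dirKernel, this]
  have e : (((1 + t ^ 2) / 2 : ℝ) : ℂ) - Complex.I * (s * t + d)
    = (((1 + t ^ 2 : ℝ) : ℂ) - 2 * Complex.I * (s * t + d)) / 2 := by push_cast; ring
  rw [e, div_pow, one_div_div]
  norm_num

/-- The boundary terms at t = ±1 of the middle piece merge with the two tail integrals: the factors
1 ∓ is - id cancel, and the sums combine to 4/(Q(1 + s²)). -/
lemma integral_dirKernel (s d : ℝ) :
    ∫ t, dirKernel s d t
      = 2 * stableAngle s d / stableRoot s d ^ 3 + 4 / (stableQ s d * (1 + s ^ 2)) := by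
  have hI := integrable_dirKernel s d
  rw [← intervalIntegral.integral_Iic_add_Ioi (b := (1 : ℝ)) hI.integrableOn hI.integrableOn,
    ← Set.Iic_union_Ioc_eq_Iic (by norm_num : (-1 : ℝ) ≤ 1),
    setIntegral_union (Set.Iic_disjoint_Ioc le_rfl) measurableSet_Ioc hI.integrableOn hI.integrableOn,
    integral_dirKernel_Iic, integral_dirKernel_Ioc, integral_dirKernel_Ioi,
    integral_one_div_quadratic_sq]
  have n1 := quadratic_ne_zero s d 1
  have n2 := quadratic_ne_zero s d (-1)
  have e1 : (((1 : ℝ) : ℂ) - Complex.I * s) ^ 2 + stableQ s d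
      = 2 * (1 - Complex.I * s - Complex.I * d) := by
    rw [quadratic_eq]; push_cast; ring
  have e2 : (((-1 : ℝ) : ℂ) - Complex.I * s) ^ 2 + stableQ s d
      = 2 * (1 + Complex.I * s - Complex.I * d) := by
    rw [quadratic_eq]; push_cast; ring
  rw [e1] at n1
  rw [e2] at n2
  have m1 : (1 - Complex.I * s - Complex.I * d : ℂ) ≠ 0 := fun h => n1 (by rw [h, mul_zero])
  have m2 : (1 + Complex.I * s - Complex.I * d : ℂ) ≠ 0 := fun h => n2 (by rw [h, mul_zero])
  have k1 := one_sub_I_mul_ne_zero s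
  have k2 := one_add_I_mul_ne_zero s
  have hQ := stableQ_ne_zero s d
  have e3 : (1 + (s : ℂ) ^ 2) = (1 - Complex.I * s) * (1 + Complex.I * s) := by
    linear_combination ((s : ℂ) ^ 2) * Complex.I_sq
  have f1 : 1 / ((1 - Complex.I * s) * (1 - Complex.I * s - Complex.I * d))
      + (1 - Complex.I * s) / (stableQ s d * (1 - Complex.I * s - Complex.I * d))
      = 2 / (stableQ s d * (1 - Complex.I * s)) := by
    field_simp
    rw [Complex.ofReal_one] at e1
    linear_combination e1
  have f2 : 1 / ((1 + Complex.I * s) * (1 + Complex.I * s - Complex.I * d))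
      + (1 + Complex.I * s) / (stableQ s d * (1 + Complex.I * s - Complex.I * d))
      = 2 / (stableQ s d * (1 + Complex.I * s)) := by
    field_simp
    push_cast at e2
    linear_combination e2
  have f3 : 4 / (stableQ s d * (1 + s ^ 2))
      = 2 / (stableQ s d * (1 - Complex.I * s)) + 2 / (stableQ s d * (1 + Complex.I * s)) := by
    rw [e3]
    field_simp
    ring
  rw [f3, ← f1, ← f2]
  ring

/-- Re Q = 1 + s² turns the real part of 4/(Q(1 + s²)) into 4/|Q|². -/
lemma stableDensity_eq_integral (s d : ℝ) :
    stableDensity s d = 1 / Real.pi ^ 2 * (∫ t, dirKernel s d t).re := by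
  rw [integral_dirKernel, stableDensity, Complex.add_re]
  have e1 : (4 / (stableQ s d * (1 + (s : ℂ) ^ 2))).re = 4 / Complex.normSq (stableQ s d) := by
    have hp : (0 : ℝ) < 1 + s ^ 2 := by positivity
    have : (1 + (s : ℂ) ^ 2) = ((1 + s ^ 2 : ℝ) : ℂ) := by push_cast; rfl
    rw [this, ← div_div, Complex.div_ofReal_re, Complex.div_re]
    simp
    field_simp
  have e2 : (2 * stableAngle s d / stableRoot s d ^ 3).re
      = 2 * (stableAngle s d / stableRoot s d ^ 3).re := by
    rw [mul_div_assoc]; simp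
  rw [e1, e2]
  ring

/-! ### The two-dimensional Fourier integral -/

/-! ### Radial integrals. -/

lemma integrable_exp_neg_mul_abs {r : ℝ} (hr : 0 < r) :
    Integrable (fun q : ℝ => Real.exp (-r * |q|)) := by
  have h1 : IntegrableOn (fun q : ℝ => Real.exp (-r * |q|)) (Set.Ioi 0) :=
    (exp_neg_integrableOn_Ioi 0 hr).congr_fun
      (fun q (hq : 0 < q) => by simp only [abs_of_pos hq]) measurableSet_Ioi
  have h2 : IntegrableOn (fun q : ℝ => Real.exp (-r * |q|)) (Set.Iio 0) := by
    have h3 : IntegrableOn (fun q : ℝ => Real.exp (-r * |q|)) (Set.Ioi (-0)) := by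
      simpa using h1
    simpa using h3.comp_neg_Iio
  have h4 : IntegrableOn (fun q : ℝ => Real.exp (-r * |q|)) (Set.Iic 0) :=
    (integrableOn_Iic_iff_integrableOn_Iio (by simp)).2 h2
  rw [← integrableOn_univ, ← Set.Iic_union_Ioi (a := (0 : ℝ))]
  exact h4.union h1

lemma abs_mul_exp_neg_le {r : ℝ} (hr : 0 < r) (q : ℝ) :
    |q| * Real.exp (-r * |q|) ≤ 2 / r * Real.exp (-(r / 2) * |q|) := by
  have h := Real.add_one_le_exp (r / 2 * |q|)
  have e : Real.exp (-(r / 2) * |q|) = Real.exp (r / 2 * |q|) * Real.exp (-r * |q|) := by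
    rw [← Real.exp_add]; congr 1; ring
  rw [e, ← mul_assoc]
  gcongr
  calc |q| = 2 / r * (r / 2 * |q|) := by field_simp
    _ ≤ _ := by gcongr; linarith

lemma integrable_abs_mul_exp_neg_mul_abs {r : ℝ} (hr : 0 < r) :
    Integrable (fun q : ℝ => |q| * Real.exp (-r * |q|)) := by
  refine ((integrable_exp_neg_mul_abs (half_pos hr)).const_mul (2 / r)).mono'
    (by fun_prop) (ae_of_all _ fun q => ?_)
  rw [Real.norm_eq_abs, abs_of_nonneg (by positivity)]
  exact abs_mul_exp_neg_le hr q

lemma norm_exp_neg_mul_ofReal (z : ℂ) (q : ℝ) :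
    ‖Complex.exp (-z * q)‖ = Real.exp (-z.re * q) := by
  rw [Complex.norm_exp]
  simp

lemma tendsto_exp_neg_mul_ofReal {z : ℂ} (hz : 0 < z.re) :
    Tendsto (fun q : ℝ => Complex.exp (-z * q)) atTop (𝓝 0) := by
  rw [tendsto_zero_iff_norm_tendsto_zero]
  simp_rw [norm_exp_neg_mul_ofReal]
  refine Real.tendsto_exp_atBot.comp ?_
  exact tendsto_id.const_mul_atTop_of_neg (by linarith)

lemma tendsto_mul_exp_neg_mul_ofReal {z : ℂ} (hz : 0 < z.re) :
    Tendsto (fun q : ℝ => (q : ℂ) * Complex.exp (-z * q)) atTop (𝓝 0) := by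
  have h : Tendsto (fun q : ℝ => 2 / z.re * Real.exp (-(z.re / 2) * q)) atTop (𝓝 0) := by
    rw [show (0 : ℝ) = 2 / z.re * 0 by simp]
    refine (Real.tendsto_exp_atBot.comp ?_).const_mul _
    exact tendsto_id.const_mul_atTop_of_neg (by linarith)
  refine squeeze_zero_norm' ?_ h
  filter_upwards [eventually_ge_atTop 0] with q hq
  have := abs_mul_exp_neg_le hz q
  rw [abs_of_nonneg hq] at this
  rw [norm_mul, norm_exp_neg_mul_ofReal, Complex.norm_real, Real.norm_eq_abs, abs_of_nonneg hq]
  exact this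

lemma integrableOn_mul_exp_neg_mul_Ioi {z : ℂ} (hz : 0 < z.re) :
    IntegrableOn (fun q : ℝ => (q : ℂ) * Complex.exp (-z * q)) (Set.Ioi 0) := by
  refine (integrable_abs_mul_exp_neg_mul_abs hz).integrableOn.mono'
    (by fun_prop) ?_
  filter_upwards [ae_restrict_mem measurableSet_Ioi] with q hq
  have hq' : 0 < q := hq
  rw [norm_mul, norm_exp_neg_mul_ofReal, Complex.norm_real, Real.norm_eq_abs, abs_of_pos hq']

lemma integral_mul_exp_neg_mul_Ioi {z : ℂ} (hz : 0 < z.re) :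
    ∫ q in Set.Ioi (0 : ℝ), (q : ℂ) * Complex.exp (-z * q) = 1 / z ^ 2 := by
  have hz0 : z ≠ 0 := fun h => by simp [h] at hz
  have hderiv : ∀ q : ℝ, HasDerivAt
      (fun q : ℝ => -(1 / z) * ((q : ℂ) * Complex.exp (-z * q))
        - 1 / z ^ 2 * Complex.exp (-z * q))
      ((q : ℂ) * Complex.exp (-z * q)) q := by
    intro q
    have h0 : HasDerivAt (fun q : ℝ => (q : ℂ)) 1 q := Complex.ofRealCLM.hasDerivAt
    have h1 := (h0.const_mul (-z)).cexp
    have h2 := ((h0.mul h1).const_mul (-(1 / z))).sub (h1.const_mul (1 / z ^ 2))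
    refine h2.congr_deriv ?_
    field_simp
    ring
  have htend : Tendsto (fun q : ℝ => -(1 / z) * ((q : ℂ) * Complex.exp (-z * q))
      - 1 / z ^ 2 * Complex.exp (-z * q)) atTop (𝓝 (-(1 / z) * 0 - 1 / z ^ 2 * 0)) :=
    ((tendsto_mul_exp_neg_mul_ofReal hz).const_mul _).sub
      ((tendsto_exp_neg_mul_ofReal hz).const_mul _)
  rw [integral_Ioi_of_hasDerivAt_of_tendsto (hderiv 0).continuousAt.continuousWithinAt
    (fun q _ => hderiv q) (integrableOn_mul_exp_neg_mul_Ioi hz) htend]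
  simp

/-- Each half-line contributes a Laplace integral 1/z², and the two values are complex conjugates.
-/
lemma integral_abs_mul_exp {r : ℝ} (hr : 0 < r) (l : ℝ) :
    ∫ q : ℝ, ((|q| * Real.exp (-r * |q|) : ℝ) : ℂ) * Complex.exp (-(q * l : ℝ) * Complex.I)
      = ((2 * (1 / ((r : ℂ) - Complex.I * l) ^ 2).re : ℝ) : ℂ) := by
  set f : ℝ → ℂ := fun q =>
    ((|q| * Real.exp (-r * |q|) : ℝ) : ℂ) * Complex.exp (-(q * l : ℝ) * Complex.I) with hf
  have hint : Integrable f := by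
    refine (integrable_abs_mul_exp_neg_mul_abs hr).mono' (by fun_prop) (ae_of_all _ fun q => ?_)
    rw [hf]
    simp only
    rw [norm_mul, Complex.norm_real, Real.norm_eq_abs, abs_of_nonneg (by positivity),
      ← Complex.ofReal_neg, Complex.norm_exp_ofReal_mul_I, mul_one]
  have e1 : ∫ q in Set.Ioi (0 : ℝ), f q = 1 / ((r : ℂ) + Complex.I * l) ^ 2 := by
    rw [← integral_mul_exp_neg_mul_Ioi (z := (r : ℂ) + Complex.I * l) (by simpa using hr)]
    refine setIntegral_congr_fun measurableSet_Ioi fun q hq => ?_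
    have hq' : 0 < q := hq
    simp only [hf, abs_of_pos hq']
    push_cast
    rw [mul_assoc, ← Complex.exp_add]
    congr 2
    ring
  have e2 : ∫ q in Set.Iic (0 : ℝ), f q = 1 / ((r : ℂ) - Complex.I * l) ^ 2 := by
    rw [← integral_mul_exp_neg_mul_Ioi (z := (r : ℂ) - Complex.I * l) (by simpa using hr)]
    rw [← neg_zero, ← integral_comp_neg_Ioi, neg_zero]
    refine setIntegral_congr_fun measurableSet_Ioi fun q hq => ?_
    have hq' : 0 < q := hq
    simp only [hf, abs_neg, abs_of_pos hq']
    push_cast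
    rw [mul_assoc, ← Complex.exp_add]
    congr 2
    ring
  rw [← intervalIntegral.integral_Iic_add_Ioi (b := (0 : ℝ)) hint.integrableOn hint.integrableOn,
    e1, e2]
  have hc : 1 / ((r : ℂ) + Complex.I * l) ^ 2
      = (starRingEnd ℂ) (1 / ((r : ℂ) - Complex.I * l) ^ 2) := by
    simp
  rw [hc, Complex.add_conj]

/-- The exponent of the characteristic function of `∫₀¹ (1, x) dL(x)`. -/
noncomputable def ciExponent (a b : ℝ) : ℝ := ∫ x in (0 : ℝ)..1, |a + b * x|

lemma continuous_ciExponent : Continuous fun p : ℝ × ℝ => ciExponent p.1 p.2 := by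
  unfold ciExponent
  exact intervalIntegral.continuous_parametric_intervalIntegral_of_continuous'
    (by fun_prop) _ _

/-- The affine function factors as q(t + 1 - 2x), separating radius and direction. -/
lemma ciExponent_eq (q t : ℝ) : ciExponent (q * (t + 1)) (-2 * q) = |q| * huber t := by
  rw [ciExponent, ← integral_abs_affine, ← intervalIntegral.integral_const_mul]
  refine intervalIntegral.integral_congr fun x _ => ?_
  rw [← abs_mul]
  congr 1
  ring

/-- The exponent is at least |b|/4 and at least |a| - |b|/2. Weighting these by 6/7 and 1/7 gives
the constant 7. -/
lemma le_ciExponent (a b : ℝ) : (|a| + |b|) / 7 ≤ ciExponent a b := by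
  by_cases hb : b = 0
  · have : ciExponent a b = |a| := by simp [ciExponent, hb]
    rw [this, hb, abs_zero]
    linarith [abs_nonneg a]
  · have e : ciExponent a b = |-b / 2| * huber (a / (-b / 2) - 1) := by
      rw [← ciExponent_eq]
      congr 1
      · field_simp; ring
      · ring
    have h1 : |b| / 4 ≤ ciExponent a b := by
      rw [e, abs_div, abs_neg, abs_two]
      have := half_le_huber (a / (-b / 2) - 1)
      nlinarith [abs_nonneg b]
    have h2 : |a| - |b| / 2 ≤ ciExponent a b := by
      rw [e]
      calc |a| - |b| / 2 ≤ |a - -b / 2| := by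
            have := abs_sub_abs_le_abs_sub a (-b / 2)
            rw [abs_div (-b), abs_neg, abs_two] at this
            exact this
        _ = |-b / 2| * |a / (-b / 2) - 1| := by
            rw [← abs_mul]; congr 1; field_simp; ring
        _ ≤ _ := by gcongr; exact abs_le_huber _
    linarith

lemma integrable_exp_neg_ciExponent :
    Integrable (fun p : ℝ × ℝ => Real.exp (-ciExponent p.1 p.2)) := by
  have h := (integrable_exp_neg_mul_abs (r := 1 / 7) (by norm_num)).mul_prod
    (integrable_exp_neg_mul_abs (r := 1 / 7) (by norm_num))
  refine h.mono' (Continuous.aestronglyMeasurable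
    (Real.continuous_exp.comp continuous_ciExponent.neg)) (ae_of_all _ fun p => ?_)
  rw [Real.norm_eq_abs, Real.abs_exp, ← Real.exp_add, Real.exp_le_exp]
  have := le_ciExponent p.1 p.2
  linarith

/-- Justifies Fubini in the polar-type coordinates: the q-integral is 2/`huber t`², which is
integrable in t. -/
lemma integrable_abs_mul_exp_huber :
    Integrable (fun p : ℝ × ℝ => |p.1| * Real.exp (-(|p.1| * huber p.2))) := by
  have hm := measurable_huber
  refine (integrable_prod_iff' (by fun_prop)).2 ⟨ae_of_all _ fun t => ?_, ?_⟩
  · refine (integrable_abs_mul_exp_neg_mul_abs (huber_pos t)).congr (ae_of_all _ fun q => ?_)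
    simp only
    congr 2
    ring
  · refine (integrable_one_div_huber_sq.const_mul 2).congr (ae_of_all _ fun t => ?_)
    have h := integral_abs_mul_exp (huber_pos t) 0
    have e : (2 * (1 / ((huber t : ℂ) - Complex.I * ((0 : ℝ) : ℂ)) ^ 2).re)
        = 2 * (1 / huber t ^ 2) := by
      have : (1 / ((huber t : ℂ) - Complex.I * ((0 : ℝ) : ℂ)) ^ 2)
          = ((1 / huber t ^ 2 : ℝ) : ℂ) := by push_cast; simp
      rw [this, Complex.ofReal_re]
    rw [e] at h
    simp only [mul_zero, Complex.ofReal_zero, neg_zero, zero_mul, Complex.exp_zero, mul_one] at h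
    rw [integral_complex_ofReal] at h
    beta_reduce
    rw [← Complex.ofReal_inj.1 h]
    refine integral_congr_ae (ae_of_all _ fun q => ?_)
    change |q| * Real.exp (-huber t * |q|) = ‖|q| * Real.exp (-(|q| * huber t))‖
    rw [Real.norm_of_nonneg (by positivity)]
    congr 2
    ring

lemma integral_exp_neg_ciExponent_mul_exp (x₀ x₁ : ℝ) :
    ∫ b : ℝ, ∫ a : ℝ, (Real.exp (-ciExponent a b) : ℂ)
        * Complex.exp (-(a * x₀ + b * x₁ : ℝ) * Complex.I)
      = ((4 * Real.pi ^ 2 * stableDensity x₀ (x₀ - 2 * x₁) : ℝ) : ℂ) := by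
  set G : ℝ → ℝ → ℂ := fun a b => (Real.exp (-ciExponent a b) : ℂ)
        * Complex.exp (-(a * x₀ + b * x₁ : ℝ) * Complex.I) with hG
  set d := x₀ - 2 * x₁ with hd
  set F : ℝ → ℝ → ℂ := fun q t => ((|q| * Real.exp (-huber t * |q|) : ℝ) : ℂ)
    * Complex.exp (-(q * (t * x₀ + d) : ℝ) * Complex.I) with hF
  -- The substitution b = -2q gives the factor 2; together with the 2 of the radial integral it
  -- makes up the 4 in 4π².
  have h1 : ∫ b : ℝ, ∫ a : ℝ, G a b = 2 * ∫ q : ℝ, ∫ a : ℝ, G a (-2 * q) := by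
    rw [Measure.integral_comp_mul_left (fun b => ∫ a : ℝ, G a b) (-2), Complex.real_smul,
      ← mul_assoc, inv_neg, abs_neg]
    norm_num
  have h2 : ∀ q : ℝ, q ≠ 0 → ∫ a : ℝ, G a (-2 * q) = ∫ t : ℝ, F q t := by
    intro q hq
    have e1 : ∫ t : ℝ, G (q * (t + 1)) (-2 * q) = ∫ t : ℝ, G (q * t) (-2 * q) :=
      integral_add_right_eq_self (fun t => G (q * t) (-2 * q)) 1
    have e2 : ∫ t : ℝ, G (q * t) (-2 * q) = |q⁻¹| • ∫ a : ℝ, G a (-2 * q) :=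
      Measure.integral_comp_mul_left (fun a => G a (-2 * q)) q
    have e3 : ∫ t : ℝ, F q t = |q| • ∫ t : ℝ, G (q * (t + 1)) (-2 * q) := by
      rw [← integral_smul]
      refine integral_congr_ae (ae_of_all _ fun t => ?_)
      simp only [hF, hG, ciExponent_eq, Complex.real_smul]
      push_cast
      rw [← mul_assoc]
      congr 2
      · congr 2; ring
      · rw [hd]; push_cast; ring
    rw [e3, e1, e2, smul_smul, ← abs_mul, mul_inv_cancel₀ hq, abs_one, one_smul]
  have h3 : ∫ q : ℝ, ∫ a : ℝ, G a (-2 * q) = ∫ q : ℝ, ∫ t : ℝ, F q t := by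
    refine integral_congr_ae ?_
    have : ∀ᵐ q : ℝ, q ≠ 0 := by simp [ae_iff, measure_singleton]
    filter_upwards [this] with q hq using h2 q hq
  have hm := measurable_huber
  have hFint : Integrable (Function.uncurry F) (volume.prod volume) := by
    refine integrable_abs_mul_exp_huber.mono' ?_ (ae_of_all _ fun p => ?_)
    · simp only [hF, Function.uncurry_def]
      fun_prop
    · simp only [hF, Function.uncurry_def]
      rw [norm_mul, Complex.norm_real, Real.norm_eq_abs, abs_of_nonneg (by positivity),
        ← Complex.ofReal_neg, Complex.norm_exp_ofReal_mul_I, mul_one]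
      refine le_of_eq ?_
      congr 2
      ring
  have h4 : ∀ t : ℝ, ∫ q : ℝ, F q t = ((2 * (dirKernel x₀ d t).re : ℝ) : ℂ) := by
    intro t
    simp only [hF]
    rw [integral_abs_mul_exp (huber_pos t), dirKernel]
    congr 6
    push_cast
    ring
  rw [h1, h3, integral_integral_swap hFint]
  simp_rw [h4]
  rw [integral_complex_ofReal, integral_const_mul, stableDensity_eq_integral]
  have h5 : ∫ t, (dirKernel x₀ d t).re = (∫ t, dirKernel x₀ d t).re :=
    Complex.reCLM.integral_comp_comm (integrable_dirKernel x₀ d)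
  rw [h5]
  have hpi : (Real.pi : ℂ) ≠ 0 := by exact_mod_cast Real.pi_ne_zero
  push_cast
  field_simp
  ring

/-! ### The law of the proposal and of the uniform variable -/

/-- The plane `ℝ × ℝ` as a Euclidean space. -/
noncomputable def planeEquiv : ℝ × ℝ ≃ᵐ EuclideanSpace ℝ (Fin 2) :=
  MeasurableEquiv.finTwoArrow.symm.trans (MeasurableEquiv.toLp 2 (Fin 2 → ℝ))

lemma planeEquiv_apply (p : ℝ × ℝ) : planeEquiv p = !₂[p.1, p.2] := by
  ext i
  fin_cases i <;> rfl

lemma measurePreserving_planeEquiv : MeasurePreserving planeEquiv :=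
  (PiLp.volume_preserving_toLp (Fin 2)).comp (volume_preserving_finTwoArrow ℝ).symm

lemma measurable_studentDensity : Measurable studentDensity := by
  unfold studentDensity
  fun_prop

lemma studentDensity_nonneg (x : EuclideanSpace ℝ (Fin 2)) : 0 ≤ studentDensity x := by
  unfold studentDensity
  positivity

lemma measurable_studentProposal :
    Measurable fun p : ℝ × ℝ × ℝ => studentProposal p.1 p.2.1 p.2.2 := by
  have : (fun p : ℝ × ℝ × ℝ => studentProposal p.1 p.2.1 p.2.2)
      = fun p : ℝ × ℝ × ℝ => planeEquiv (p.1 / √p.2.2, (p.1 + p.2.1) / (2 * √p.2.2)) := by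
    ext1 p; rw [planeEquiv_apply]; rfl
  rw [this]
  exact planeEquiv.measurable.comp (by fun_prop)

lemma lintegral_gaussianReal {f : ℝ → ℝ≥0∞} (hf : Measurable f) :
    ∫⁻ x, f x ∂(gaussianReal 0 1) = ∫⁻ x, gaussianPDF 0 1 x * f x := by
  rw [gaussianReal_of_var_ne_zero 0 one_ne_zero,
    lintegral_withDensity_eq_lintegral_mul _ (measurable_gaussianPDF 0 1) hf]
  rfl

lemma lintegral_eq_lintegral_affine {f : ℝ → ℝ≥0∞} (hf : Measurable f) {a : ℝ} (ha : a ≠ 0)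
    (b : ℝ) : ∫⁻ y, f y = ENNReal.ofReal |a| * ∫⁻ x, f (a * x + b) := by
  have h1 : ∫⁻ x, f (a * x + b) = ∫⁻ y, f (y + b) ∂(Measure.map (a * ·) volume) := by
    rw [lintegral_map (by fun_prop) (by fun_prop)]
  rw [h1, ← smul_eq_mul, ← lintegral_smul_measure, Real.smul_map_volume_mul_left ha,
    lintegral_add_right_eq_self f b]

lemma lintegral_sq_gaussianReal {v : ℝ≥0} :
    ∫⁻ x, ENNReal.ofReal (x ^ 2) ∂(gaussianReal 0 v) = v := by
  have hint : Integrable (fun x : ℝ => x ^ 2) (gaussianReal 0 v) :=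
    (memLp_id_gaussianReal (μ := 0) (v := v) 2).integrable_sq
  have h := variance_fun_id_gaussianReal (μ := 0) (v := v)
  rw [variance_eq_integral measurable_id'.aemeasurable] at h
  simp only [integral_id_gaussianReal, sub_zero] at h
  rw [← ofReal_integral_eq_lintegral_ofReal hint (ae_of_all _ fun x => sq_nonneg x), h,
    ENNReal.ofReal_coe_nnreal]

/-- With k = 1 + a² + b², the three Gaussian densities multiply to a constant times the N(0, 1/k)
density in v. Its normalisation contributes k^(-1/2), its second moment 1/k. -/
lemma lintegral_sq_mul_gaussian_triple (a b : ℝ) :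
    ∫⁻ v, ENNReal.ofReal (2 * v ^ 2) * (gaussianPDF 0 1 v * gaussianPDF 0 1 (|v| * a)
        * gaussianPDF 0 1 (|v| * b))
      = ENNReal.ofReal (1 / Real.pi * (1 + a ^ 2 + b ^ 2) ^ (-(3 / 2) : ℝ)) := by
  have hk : 0 < 1 + a ^ 2 + b ^ 2 := by positivity
  set k := 1 + a ^ 2 + b ^ 2 with hkdef
  set κ : ℝ≥0 := ⟨k⁻¹, by positivity⟩ with hκ
  have hκ0 : κ ≠ 0 := by
    refine NNReal.coe_ne_zero.1 ?_
    rw [hκ]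
    exact inv_ne_zero hk.ne'
  have hκc : (κ : ℝ) = k⁻¹ := rfl
  have hs : 0 < √k := Real.sqrt_pos.2 hk
  have key : ∀ v : ℝ, ENNReal.ofReal (2 * v ^ 2) * (gaussianPDF 0 1 v * gaussianPDF 0 1 (|v| * a)
        * gaussianPDF 0 1 (|v| * b))
      = ENNReal.ofReal (1 / (Real.pi * √k)) * (gaussianPDF 0 κ v * ENNReal.ofReal (v ^ 2)) := by
    intro v
    simp only [gaussianPDF]
    rw [← ENNReal.ofReal_mul (gaussianPDFReal_nonneg _ _ _),
      ← ENNReal.ofReal_mul (mul_nonneg (gaussianPDFReal_nonneg _ _ _) (gaussianPDFReal_nonneg _ _ _)),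
      ← ENNReal.ofReal_mul (by positivity), ← ENNReal.ofReal_mul (gaussianPDFReal_nonneg _ _ _),
      ← ENNReal.ofReal_mul (by positivity)]
    congr 1
    simp only [gaussianPDFReal, hκc, NNReal.coe_one, mul_one, sub_zero]
    have e1 : Real.exp (-v ^ 2 / 2) * Real.exp (-(|v| * a) ^ 2 / 2) * Real.exp (-(|v| * b) ^ 2 / 2)
        = Real.exp (-v ^ 2 / (2 * k⁻¹)) := by
      rw [← Real.exp_add, ← Real.exp_add]
      congr 1
      rw [mul_pow, mul_pow, sq_abs, hkdef]
      field_simp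
      ring
    rw [← e1, ← div_eq_mul_inv, Real.sqrt_div (by positivity)]
    have hp : 0 < √(2 * Real.pi) := Real.sqrt_pos.2 (by positivity)
    have hp2 : √(2 * Real.pi) ^ 2 = 2 * Real.pi := Real.sq_sqrt (by positivity)
    field_simp
    rw [hp2]
    ring
  simp_rw [key]
  rw [lintegral_const_mul' _ _ ENNReal.ofReal_ne_top]
  have h1 : ∫⁻ v, gaussianPDF 0 κ v * ENNReal.ofReal (v ^ 2) = κ := by
    rw [← lintegral_sq_gaussianReal, gaussianReal_of_var_ne_zero 0 hκ0,
      lintegral_withDensity_eq_lintegral_mul _ (measurable_gaussianPDF 0 κ) (by fun_prop)]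
    rfl
  rw [h1, ← ENNReal.ofReal_coe_nnreal, ← ENNReal.ofReal_mul (by positivity), hκc]
  congr 1
  have e2 : k ^ (-(3 / 2) : ℝ) = 1 / (√k * k) := by
    rw [Real.rpow_neg hk.le, show (3 / 2 : ℝ) = 1 / 2 + 1 by norm_num, Real.rpow_add hk,
      Real.rpow_one, ← Real.sqrt_eq_rpow, one_div]
  rw [e2]
  field_simp

/-- Solving x₀ = y₁/r, x₁ = (y₁ + y₂)/(2r) gives y₁ = r x₀ and y₂ = r(2x₁ - x₀), with Jacobian 2r².
-/
lemma lintegral_scaled_gaussian {Φ : ℝ × ℝ → ℝ≥0∞} (hΦ : Measurable Φ) {r : ℝ} (hr : 0 < r) :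
    ∫⁻ y₁, ∫⁻ y₂, Φ (y₁ / r, (y₁ + y₂) / (2 * r)) ∂(gaussianReal 0 1) ∂(gaussianReal 0 1)
      = ∫⁻ x₀, ∫⁻ x₁, ENNReal.ofReal (2 * r ^ 2) * (gaussianPDF 0 1 (r * x₀)
        * gaussianPDF 0 1 (r * (2 * x₁ - x₀))) * Φ (x₀, x₁) := by
  have hm := measurable_gaussianPDF 0 1
  have h1 : ∀ y₁ : ℝ, ∫⁻ y₂, Φ (y₁ / r, (y₁ + y₂) / (2 * r)) ∂(gaussianReal 0 1)
      = ENNReal.ofReal (2 * r) * ∫⁻ x₁, gaussianPDF 0 1 (2 * r * x₁ - y₁) * Φ (y₁ / r, x₁) := by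
    intro y₁
    rw [lintegral_gaussianReal (by fun_prop),
      lintegral_eq_lintegral_affine (by fun_prop) (a := 2 * r) (by positivity) (-y₁),
      abs_of_pos (by positivity)]
    congr 1
    refine lintegral_congr fun x₁ => ?_
    rw [← sub_eq_add_neg]
    congr 3
    field_simp
    ring
  simp_rw [h1]
  rw [lintegral_gaussianReal (by fun_prop),
    lintegral_eq_lintegral_affine (by fun_prop) (a := r) hr.ne' 0, abs_of_pos hr,
    ← lintegral_const_mul _ (by fun_prop)]
  refine lintegral_congr fun x₀ => ?_
  rw [← mul_assoc, ← mul_assoc, ← lintegral_const_mul _ (by fun_prop)]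
  refine lintegral_congr fun x₁ => ?_
  have e1 : r * (2 * x₁ - x₀) = 2 * r * x₁ - (r * x₀ + 0) := by ring
  have e2 : (r * x₀ + 0) / r = x₀ := by field_simp; ring
  have e3 : ENNReal.ofReal (2 * r ^ 2) = ENNReal.ofReal r * ENNReal.ofReal (2 * r) := by
    rw [← ENNReal.ofReal_mul hr.le]; congr 1; ring
  rw [e1, e2, e3, add_zero]
  ring

/-- Writing W = v² with v normal makes √W = |v|. For fixed v ≠ 0 the proposal is an affine image of
a Gaussian pair; integrating v out last gives the Student density. -/
lemma lintegral_studentProposal {φ : EuclideanSpace ℝ (Fin 2) → ℝ≥0∞} (hφ : Measurable φ) :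
    ∫⁻ y₁, ∫⁻ y₂, ∫⁻ w, φ (studentProposal y₁ y₂ w) ∂chiSqOne ∂(gaussianReal 0 1)
        ∂(gaussianReal 0 1)
      = ∫⁻ x, ENNReal.ofReal (studentDensity x) * φ x := by
  have hm := measurable_gaussianPDF 0 1
  set Φ : ℝ × ℝ → ℝ≥0∞ := fun p => φ (planeEquiv p) with hΦdef
  have hΦ : Measurable Φ := hφ.comp planeEquiv.measurable
  have h1 : ∀ y₁ y₂ : ℝ, ∫⁻ w, φ (studentProposal y₁ y₂ w) ∂chiSqOne
      = ∫⁻ v, Φ (y₁ / |v|, (y₁ + y₂) / (2 * |v|)) ∂(gaussianReal 0 1) := by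
    intro y₁ y₂
    have hsp : Measurable fun w => studentProposal y₁ y₂ w :=
      measurable_studentProposal.comp (by fun_prop : Measurable fun w : ℝ => (y₁, y₂, w))
    rw [chiSqOne, lintegral_map (f := fun w => φ (studentProposal y₁ y₂ w)) (hφ.comp hsp)
      (by fun_prop)]
    refine lintegral_congr fun v => ?_
    rw [hΦdef]
    simp only [planeEquiv_apply, studentProposal, Real.sqrt_sq_eq_abs]
  simp_rw [h1]
  have h2 : ∀ y₁ : ℝ, ∫⁻ y₂, ∫⁻ v, Φ (y₁ / |v|, (y₁ + y₂) / (2 * |v|)) ∂(gaussianReal 0 1)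
        ∂(gaussianReal 0 1)
      = ∫⁻ v, ∫⁻ y₂, Φ (y₁ / |v|, (y₁ + y₂) / (2 * |v|)) ∂(gaussianReal 0 1)
        ∂(gaussianReal 0 1) := by
    intro y₁
    exact lintegral_lintegral_swap (Measurable.aemeasurable (by fun_prop))
  simp_rw [h2]
  rw [lintegral_lintegral_swap (Measurable.aemeasurable (by fun_prop)),
    lintegral_gaussianReal (by fun_prop)]
  have h3 : ∫⁻ v, gaussianPDF 0 1 v * ∫⁻ y₁, ∫⁻ y₂, Φ (y₁ / |v|, (y₁ + y₂) / (2 * |v|))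
        ∂(gaussianReal 0 1) ∂(gaussianReal 0 1)
      = ∫⁻ v, ∫⁻ x₀, ∫⁻ x₁, ENNReal.ofReal (2 * v ^ 2) * (gaussianPDF 0 1 v
        * gaussianPDF 0 1 (|v| * x₀) * gaussianPDF 0 1 (|v| * (2 * x₁ - x₀))) * Φ (x₀, x₁) := by
    refine lintegral_congr_ae ?_
    have : ∀ᵐ q : ℝ, q ≠ 0 := by simp [ae_iff, measure_singleton]
    filter_upwards [this] with v hv
    rw [lintegral_scaled_gaussian hΦ (abs_pos.2 hv), ← lintegral_const_mul _ (by fun_prop)]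
    refine lintegral_congr fun x₀ => ?_
    rw [← lintegral_const_mul _ (by fun_prop)]
    refine lintegral_congr fun x₁ => ?_
    rw [sq_abs]
    ring
  rw [h3, lintegral_lintegral_swap (Measurable.aemeasurable (by fun_prop))]
  have h4 : ∀ x₀ : ℝ, ∫⁻ v, ∫⁻ x₁, ENNReal.ofReal (2 * v ^ 2) * (gaussianPDF 0 1 v
        * gaussianPDF 0 1 (|v| * x₀) * gaussianPDF 0 1 (|v| * (2 * x₁ - x₀))) * Φ (x₀, x₁)
      = ∫⁻ x₁, ENNReal.ofReal (1 / Real.pi * (1 + x₀ ^ 2 + (2 * x₁ - x₀) ^ 2) ^ (-(3 / 2) : ℝ))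
        * Φ (x₀, x₁) := by
    intro x₀
    rw [lintegral_lintegral_swap (Measurable.aemeasurable (by fun_prop))]
    refine lintegral_congr fun x₁ => ?_
    rw [lintegral_mul_const _ (by fun_prop), lintegral_sq_mul_gaussian_triple]
  simp_rw [h4]
  have hd := measurable_studentDensity
  rw [← measurePreserving_planeEquiv.lintegral_comp (by fun_prop), Measure.volume_eq_prod,
    lintegral_prod _ ((by fun_prop : Measurable fun p =>
      ENNReal.ofReal (studentDensity (planeEquiv p)) * φ (planeEquiv p)).aemeasurable)]
  refine lintegral_congr fun x₀ => lintegral_congr fun x₁ => ?_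
  simp [hΦdef, planeEquiv_apply, studentDensity]

lemma lintegral_studentDensity : ∫⁻ x, ENNReal.ofReal (studentDensity x) = 1 := by
  have h := lintegral_studentProposal (φ := fun _ => 1) measurable_const
  have : IsProbabilityMeasure chiSqOne := Measure.isProbabilityMeasure_map (by fun_prop)
  simpa using h.symm

lemma integrable_studentDensity : Integrable studentDensity := by
  refine ⟨measurable_studentDensity.aestronglyMeasurable, ?_⟩
  rw [hasFiniteIntegral_iff_ofReal (ae_of_all _ studentDensity_nonneg), lintegral_studentDensity]
  exact ENNReal.one_lt_top

lemma lintegral_Ioi_mul_exp_neg_sq_half {R : ℝ} (hR : 0 ≤ R) :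
    ∫⁻ r in Set.Ioi R, ENNReal.ofReal (r * Real.exp (-r ^ 2 / 2))
      = ENNReal.ofReal (Real.exp (-R ^ 2 / 2)) := by
  have hderiv : ∀ x ∈ Set.Ici R, HasDerivAt (fun r : ℝ => -Real.exp (-r ^ 2 / 2))
      (x * Real.exp (-x ^ 2 / 2)) x := by
    intro x _
    have h := (((hasDerivAt_pow 2 x).neg.div_const 2).exp).neg
    refine h.congr_deriv ?_
    simp
    ring
  have hpos : ∀ x ∈ Set.Ioi R, 0 ≤ x * Real.exp (-x ^ 2 / 2) := fun x hx =>
    mul_nonneg (hR.trans (le_of_lt hx)) (Real.exp_pos _).le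
  have htend : Tendsto (fun r : ℝ => -Real.exp (-r ^ 2 / 2)) atTop (𝓝 0) := by
    rw [← neg_zero]
    refine (Real.tendsto_exp_atBot.comp ?_).neg
    have h : Tendsto (fun r : ℝ => r ^ 2 / 2) atTop atTop :=
      (tendsto_pow_atTop two_ne_zero).atTop_div_const two_pos
    refine (tendsto_neg_atTop_atBot.comp h).congr fun r => ?_
    simp [neg_div]
  have hint := integrableOn_Ioi_deriv_of_nonneg' hderiv hpos htend
  rw [← ofReal_integral_eq_lintegral_ofReal hint
    ((ae_restrict_iff' measurableSet_Ioi).2 (ae_of_all _ hpos)),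
    integral_Ioi_of_hasDerivAt_of_nonneg' hderiv hpos htend]
  simp

/-- The Box–Muller computation: in polar coordinates the event is r ≥ √(-2 log c), of probability c.
Nonpositive c is included because f has not been shown nonnegative pointwise. -/
lemma lintegral_exp_gaussian_le {c : ℝ} (hc : c ≤ 1) :
    ∫⁻ v₁, ∫⁻ v₂, (if Real.exp (-(v₁ ^ 2 + v₂ ^ 2) / 2) ≤ c then 1 else 0 : ℝ≥0∞)
        ∂(gaussianReal 0 1) ∂(gaussianReal 0 1) = ENNReal.ofReal c := by
  rcases le_or_gt c 0 with h0 | h0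
  · rw [ENNReal.ofReal_of_nonpos h0]
    have : ∀ v₁ v₂ : ℝ, (if Real.exp (-(v₁ ^ 2 + v₂ ^ 2) / 2) ≤ c then 1 else 0 : ℝ≥0∞) = 0 :=
      fun v₁ v₂ => if_neg (not_le.2 (h0.trans_lt (Real.exp_pos _)))
    simp only [this, lintegral_zero]
  have hm := measurable_gaussianPDF 0 1
  have hind : Measurable fun p : ℝ × ℝ =>
      (if Real.exp (-(p.1 ^ 2 + p.2 ^ 2) / 2) ≤ c then 1 else 0 : ℝ≥0∞) :=
    Measurable.ite (measurableSet_le (by fun_prop) measurable_const) measurable_const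
      measurable_const
  have hind' : ∀ v₁ : ℝ, Measurable fun v₂ : ℝ =>
      (if Real.exp (-(v₁ ^ 2 + v₂ ^ 2) / 2) ≤ c then 1 else 0 : ℝ≥0∞) := fun v₁ =>
    hind.comp (by fun_prop : Measurable fun v₂ : ℝ => (v₁, v₂))
  simp_rw [fun v₁ => lintegral_gaussianReal (hind' v₁)]
  rw [lintegral_gaussianReal (by
    refine Measurable.lintegral_prod_right' (f := fun p : ℝ × ℝ => gaussianPDF 0 1 p.2 *
      (if Real.exp (-(p.1 ^ 2 + p.2 ^ 2) / 2) ≤ c then 1 else 0 : ℝ≥0∞)) ?_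
    fun_prop)]
  have e1 : ∫⁻ x, gaussianPDF 0 1 x * ∫⁻ y, gaussianPDF 0 1 y
        * (if Real.exp (-(x ^ 2 + y ^ 2) / 2) ≤ c then 1 else 0 : ℝ≥0∞)
      = ∫⁻ p : ℝ × ℝ, gaussianPDF 0 1 p.1 * (gaussianPDF 0 1 p.2
        * (if Real.exp (-(p.1 ^ 2 + p.2 ^ 2) / 2) ≤ c then 1 else 0 : ℝ≥0∞)) := by
    rw [Measure.volume_eq_prod, lintegral_prod _ (by fun_prop)]
    refine lintegral_congr fun x => ?_
    rw [← lintegral_const_mul _ (by have := hind' x; fun_prop)]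
  rw [e1, ← lintegral_comp_polarCoord_symm]
  set R := √(-2 * Real.log c) with hRdef
  have hlog : 0 ≤ -2 * Real.log c := by have := Real.log_nonpos h0.le hc; linarith
  have hR2 : R ^ 2 = -2 * Real.log c := Real.sq_sqrt hlog
  have e2 : ∀ p ∈ polarCoord.target, ENNReal.ofReal p.1 • (gaussianPDF 0 1 (polarCoord.symm p).1 *
      (gaussianPDF 0 1 (polarCoord.symm p).2 *
        (if Real.exp (-((polarCoord.symm p).1 ^ 2 + (polarCoord.symm p).2 ^ 2) / 2) ≤ c
          then 1 else 0 : ℝ≥0∞)))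
      = (Set.Ici R).indicator (fun r => ENNReal.ofReal (r * Real.exp (-r ^ 2 / 2))) p.1
        * ENNReal.ofReal (1 / (2 * Real.pi)) := by
    intro p hp
    have hp1 : 0 < p.1 := hp.1
    have hsum : (polarCoord.symm p).1 ^ 2 + (polarCoord.symm p).2 ^ 2 = p.1 ^ 2 := by
      simp only [polarCoord_symm_apply]
      linear_combination p.1 ^ 2 * Real.cos_sq_add_sin_sq p.2
    have hpdf : gaussianPDF 0 1 (polarCoord.symm p).1 * gaussianPDF 0 1 (polarCoord.symm p).2
        = ENNReal.ofReal (Real.exp (-p.1 ^ 2 / 2)) * ENNReal.ofReal (1 / (2 * Real.pi)) := by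
      simp only [gaussianPDF]
      rw [← ENNReal.ofReal_mul (gaussianPDFReal_nonneg _ _ _),
        ← ENNReal.ofReal_mul (Real.exp_pos _).le]
      congr 1
      simp only [gaussianPDFReal, NNReal.coe_one, mul_one, sub_zero]
      have hp2 : √(2 * Real.pi) * √(2 * Real.pi) = 2 * Real.pi :=
        Real.mul_self_sqrt (by positivity)
      rw [mul_mul_mul_comm, ← mul_inv, hp2, ← Real.exp_add, ← hsum]
      rw [mul_comm, one_div]
      congr 2
      ring
    have hiff : Real.exp (-((polarCoord.symm p).1 ^ 2 + (polarCoord.symm p).2 ^ 2) / 2) ≤ c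
        ↔ p.1 ∈ Set.Ici R := by
      rw [hsum, ← Real.le_log_iff_exp_le h0, Set.mem_Ici, hRdef, Real.sqrt_le_left hp1.le]
      constructor <;> intro h <;> linarith
    rw [← mul_assoc, hpdf, smul_eq_mul]
    by_cases hmem : p.1 ∈ Set.Ici R
    · rw [if_pos (hiff.2 hmem), Set.indicator_of_mem hmem, mul_one, ENNReal.ofReal_mul hp1.le,
        mul_assoc]
    · rw [if_neg (fun h => hmem (hiff.1 h)), Set.indicator_of_notMem hmem]
      simp
  rw [setLIntegral_congr_fun polarCoord.open_target.measurableSet e2, polarCoord_target,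
    Measure.volume_eq_prod, ← Measure.prod_restrict]
  have hmI : Measurable ((Set.Ici R).indicator
      (fun r => ENNReal.ofReal (r * Real.exp (-r ^ 2 / 2)))) :=
    Measurable.indicator (by fun_prop) measurableSet_Ici
  rw [lintegral_prod _ (Measurable.aemeasurable (by fun_prop))]
  simp only [lintegral_const, Measure.restrict_apply_univ, Real.volume_Ioo]
  rw [lintegral_mul_const _ (hmI.mul_const _), lintegral_mul_const _ hmI,
    setLIntegral_indicator measurableSet_Ici]
  have e3 : ∫⁻ r in Set.Ici R ∩ Set.Ioi 0, ENNReal.ofReal (r * Real.exp (-r ^ 2 / 2))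
      = ENNReal.ofReal (Real.exp (-R ^ 2 / 2)) := by
    rw [← lintegral_Ioi_mul_exp_neg_sq_half (Real.sqrt_nonneg _)]
    refine setLIntegral_congr ?_
    have : (Set.Ioi R : Set ℝ) = Set.Ioi R ∩ Set.Ioi 0 :=
      (Set.inter_eq_left.2 (Set.Ioi_subset_Ioi (Real.sqrt_nonneg _))).symm
    rw [this]
    exact Ioi_ae_eq_Ici.symm.inter (ae_eq_refl _)
  rw [e3, hR2, mul_assoc, ← ENNReal.ofReal_mul (by positivity)]
  have e4 : 1 / (2 * Real.pi) * (Real.pi - -Real.pi) = 1 := by field_simp; ring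
  rw [e4, ENNReal.ofReal_one, mul_one]
  congr 1
  rw [show -(-2 * Real.log c) / 2 = Real.log c by ring, Real.exp_log h0]

/-! ### Fourier inversion -/

open scoped FourierTransform RealInnerProductSpace in
lemma fourier_exp_neg_ciExponent (w : EuclideanSpace ℝ (Fin 2)) :
    𝓕 (fun u : EuclideanSpace ℝ (Fin 2) => (Real.exp (-ciExponent (u 0) (u 1)) : ℂ)) w
      = ((4 * Real.pi ^ 2 * ciDensity ((2 * Real.pi) • w) : ℝ) : ℂ) := by
  rw [Real.fourier_eq', ciDensity_eq_stableDensity, PiLp.smul_apply, PiLp.smul_apply, smul_eq_mul,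
    smul_eq_mul, ← integral_exp_neg_ciExponent_mul_exp, ← measurePreserving_planeEquiv.integral_comp
      planeEquiv.measurableEmbedding, Measure.volume_eq_prod, integral_prod_symm]
  · refine integral_congr_ae (ae_of_all _ fun b => integral_congr_ae (ae_of_all _ fun a => ?_))
    simp only [planeEquiv_apply, PiLp.inner_apply, Fin.sum_univ_two, smul_eq_mul]
    simp
    rw [mul_comm]
    congr 2
    ring
  · refine integrable_exp_neg_ciExponent.mono' ?_ (ae_of_all _ fun p => ?_)
    · refine Continuous.aestronglyMeasurable ?_
      have h1 := continuous_ciExponent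
      have h2 : Continuous fun p : ℝ × ℝ => planeEquiv p := by
        have : (fun p : ℝ × ℝ => planeEquiv p) = fun p : ℝ × ℝ => !₂[p.1, p.2] :=
          funext planeEquiv_apply
        rw [this]
        fun_prop
      have h3 : Continuous fun p : ℝ × ℝ => ciExponent (planeEquiv p 0) (planeEquiv p 1) := by
        have : (fun p : ℝ × ℝ => ciExponent (planeEquiv p 0) (planeEquiv p 1))
          = fun p : ℝ × ℝ => ciExponent p.1 p.2 := by
          ext1 p; rw [planeEquiv_apply]; rfl
        rw [this]
        exact h1
      simp only [smul_eq_mul]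
      fun_prop
    · rw [smul_eq_mul, norm_mul, Complex.norm_exp_ofReal_mul_I, one_mul, Complex.norm_real,
        Real.norm_of_nonneg (Real.exp_pos _).le, planeEquiv_apply]
      rfl

lemma measurable_ciDensity : Measurable ciDensity := by
  unfold ciDensity ciQ Complex.arctan
  refine Measurable.ite (measurableSet_eq_fun (by fun_prop) (by fun_prop)) (by fun_prop) ?_
  fun_prop

lemma integrable_ciDensity : Integrable ciDensity :=
  (integrable_studentDensity.const_mul (25 / Real.pi)).mono'
    measurable_ciDensity.aestronglyMeasurable (ae_of_all _ abs_ciDensity_le)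

open scoped FourierTransform RealInnerProductSpace in
-- Fourier inversion applies because the transform is integrable, thanks to the Student envelope.
-- Rescaling by 2π in the plane cancels the factor 4π².
lemma integral_exp_inner_mul_ciDensity (u : EuclideanSpace ℝ (Fin 2)) :
    ∫ x, Complex.exp (⟪x, u⟫ * Complex.I) * ciDensity x
      = Complex.exp (-ciExponent (u 0) (u 1)) := by
  set ψ : EuclideanSpace ℝ (Fin 2) → ℂ := fun u => (Real.exp (-ciExponent (u 0) (u 1)) : ℂ) with hψ
  have hcont0 : Continuous fun u : EuclideanSpace ℝ (Fin 2) => ciExponent (u 0) (u 1) :=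
    continuous_ciExponent.comp (by fun_prop : Continuous fun u : EuclideanSpace ℝ (Fin 2) =>
      (u 0, u 1))
  have hcont : Continuous ψ := by fun_prop
  have hint : Integrable ψ := by
    rw [← measurePreserving_planeEquiv.integrable_comp_emb planeEquiv.measurableEmbedding]
    refine integrable_exp_neg_ciExponent.ofReal.congr (ae_of_all _ fun p => ?_)
    simp [hψ, planeEquiv_apply]
  have hF : 𝓕 ψ = fun w => ((4 * Real.pi ^ 2 * ciDensity ((2 * Real.pi) • w) : ℝ) : ℂ) :=
    funext fourier_exp_neg_ciExponent
  have hFint : Integrable (𝓕 ψ) := by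
    rw [hF]
    refine Integrable.ofReal (Integrable.const_mul ?_ _)
    exact integrable_ciDensity.comp_smul (by positivity)
  have hinv := congrFun (hcont.fourierInv_fourier_eq hint hFint) u
  rw [Real.fourierInv_eq', hF] at hinv
  have hscale := Measure.integral_comp_smul (volume : Measure (EuclideanSpace ℝ (Fin 2)))
    (fun x : EuclideanSpace ℝ (Fin 2) => Complex.exp (⟪x, u⟫ * Complex.I) * ciDensity x)
    (2 * Real.pi)
  rw [finrank_euclideanSpace, Fintype.card_fin] at hscale
  have e : ∫ v : EuclideanSpace ℝ (Fin 2), Complex.exp (((2 * Real.pi * ⟪v, u⟫ : ℝ) : ℂ) * Complex.I) •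
      ((4 * Real.pi ^ 2 * ciDensity ((2 * Real.pi) • v) : ℝ) : ℂ)
      = (4 * Real.pi ^ 2 : ℝ) • ∫ x : EuclideanSpace ℝ (Fin 2),
        Complex.exp (⟪(2 * Real.pi) • x, u⟫ * Complex.I) * ciDensity ((2 * Real.pi) • x) := by
    rw [← integral_smul]
    refine integral_congr_ae (ae_of_all _ fun v => ?_)
    simp only [real_inner_smul_left, Complex.real_smul, smul_eq_mul]
    push_cast
    ring
  rw [e, hscale, smul_smul, abs_of_pos (by positivity)] at hinv
  have hpi := Real.pi_pos
  rw [show 4 * Real.pi ^ 2 * ((2 * Real.pi) ^ 2)⁻¹ = 1 by field_simp; norm_num, one_smul] at hinv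
  rw [hinv, hψ]
  push_cast
  rfl

open scoped RealInnerProductSpace in
lemma charFun_withDensity_ofReal {E : Type*} [NormedAddCommGroup E] [InnerProductSpace ℝ E]
    [MeasurableSpace E] {ν : Measure E} {f : E → ℝ} (hf : Measurable f) (u : E) :
    charFun (ν.withDensity fun x => ENNReal.ofReal (f x)) u
      = ∫ x, Complex.exp (⟪x, u⟫ * Complex.I) * ((max (f x) 0 : ℝ) : ℂ) ∂ν := by
  rw [charFun_apply, integral_withDensity_eq_integral_toReal_smul (by fun_prop)
    (ae_of_all _ fun x => ENNReal.ofReal_lt_top)]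
  refine integral_congr_ae (ae_of_all _ fun x => ?_)
  simp only [ENNReal.toReal_ofReal', Complex.real_smul]
  ring

open scoped RealInnerProductSpace in
/-- A finite measure whose characteristic function is the Fourier integral of an integrable real
function `f` has density `f`. -/
lemma eq_withDensity_of_charFun {E : Type*} [NormedAddCommGroup E] [InnerProductSpace ℝ E]
    [MeasurableSpace E] [BorelSpace E] [SecondCountableTopology E] [CompleteSpace E]
    {ν μ : Measure E} [IsFiniteMeasure μ] {f : E → ℝ} (hm : Measurable f) (hf : Integrable f ν)
    (h : ∀ u, charFun μ u = ∫ x, Complex.exp (⟪x, u⟫ * Complex.I) * f x ∂ν) :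
    μ = ν.withDensity fun x => ENNReal.ofReal (f x) := by
  set νp := ν.withDensity fun x => ENNReal.ofReal (f x) with hνp
  set νm := ν.withDensity fun x => ENNReal.ofReal (-f x) with hνm
  have hfp : IsFiniteMeasure νp := isFiniteMeasure_withDensity_ofReal hf.2
  have hfm : IsFiniteMeasure νm := isFiniteMeasure_withDensity_ofReal hf.neg.2
  have hexp : ∀ {g : E → ℝ}, Integrable g ν → ∀ u : E,
      Integrable (fun x => Complex.exp (⟪x, u⟫ * Complex.I) * (g x : ℂ)) ν := by
    intro g hg u
    refine hg.ofReal.bdd_mul (c := 1) (by fun_prop) (ae_of_all _ fun x => ?_)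
    rw [Complex.norm_exp_ofReal_mul_I]
  -- With f = f⁺ - f⁻, the hypothesis says that μ + f⁻ν and f⁺ν have the same characteristic
  -- function. Then f⁻ν is dominated by f⁺ν, which is null where f < 0, while f⁻ν is null elsewhere;
  -- hence f⁻ν = 0.
  have hsum : μ + νm = νp := by
    refine Measure.ext_of_charFun (funext fun u => ?_)
    have e1 : charFun (μ + νm) u = charFun μ u + charFun νm u := by
      simp only [charFun_apply]
      refine integral_add_measure ?_ ?_ <;>
      · refine (integrable_const (1 : ℝ)).mono' (by fun_prop) (ae_of_all _ fun x => ?_)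
        rw [Complex.norm_exp_ofReal_mul_I]
    rw [e1, h, hνm, charFun_withDensity_ofReal (f := fun x => -f x) hm.neg,
      charFun_withDensity_ofReal hm,
      ← integral_add (hexp hf u) (hexp (g := fun x => max (-f x) 0) hf.neg.pos_part u)]
    refine integral_congr_ae (ae_of_all _ fun x => ?_)
    beta_reduce
    rw [← mul_add, ← Complex.ofReal_add]
    congr 2
    rcases le_total (f x) 0 with h0 | h0
    · rw [max_eq_left (by linarith), max_eq_right h0]; ring
    · rw [max_eq_right (by linarith), max_eq_left h0]; ring
  have hS : MeasurableSet {x | f x < 0} := measurableSet_lt hm measurable_const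
  have hp0 : νp {x | f x < 0} = 0 := by
    rw [hνp, withDensity_apply _ hS, setLIntegral_congr_fun (g := fun _ => 0) hS
      fun x hx => ENNReal.ofReal_of_nonpos (le_of_lt hx)]
    simp
  have hm0 : νm {x | f x < 0} = 0 := by
    have := congrArg (fun m : Measure E => m {x | f x < 0}) hsum
    simp only [Measure.add_apply, hp0] at this
    exact (add_eq_zero.1 this).2
  have hm1 : νm {x | f x < 0}ᶜ = 0 := by
    rw [hνm, withDensity_apply _ hS.compl, setLIntegral_congr_fun (g := fun _ => 0) hS.compl
      fun x hx => ENNReal.ofReal_of_nonpos (by simpa using hx)]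
    simp
  have hz : νm = 0 := by
    rw [← Measure.measure_univ_eq_zero, ← Set.union_compl_self {x | f x < 0}]
    exact measure_union_null hm0 hm1
  rw [← hsum, hz, add_zero]

/-! ### The characteristic function of the stochastic integral -/

lemma integral_exp_neg_abs_mul_exp {r : ℝ} (hr : 0 < r) (l : ℝ) :
    ∫ q : ℝ, (Real.exp (-r * |q|) : ℂ) * Complex.exp (-(q * l : ℝ) * Complex.I)
      = ((2 * r / (r ^ 2 + l ^ 2) : ℝ) : ℂ) := by
  set f : ℝ → ℂ := fun q =>
    (Real.exp (-r * |q|) : ℂ) * Complex.exp (-(q * l : ℝ) * Complex.I) with hf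
  have hint : Integrable f := by
    refine (integrable_exp_neg_mul_abs hr).mono' (by fun_prop) (ae_of_all _ fun q => ?_)
    rw [hf]
    simp only
    rw [norm_mul, Complex.norm_real, Real.norm_eq_abs, Real.abs_exp,
      ← Complex.ofReal_neg, Complex.norm_exp_ofReal_mul_I, mul_one]
  have e1 : ∫ q in Set.Ioi (0 : ℝ), f q = 1 / ((r : ℂ) + Complex.I * l) := by
    have h := integral_exp_mul_complex_Ioi (a := -((r : ℂ) + Complex.I * l)) (by simpa using hr) 0
    rw [Complex.ofReal_zero, mul_zero, Complex.exp_zero, neg_div_neg_eq] at h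
    rw [← h]
    refine setIntegral_congr_fun measurableSet_Ioi fun q hq => ?_
    have hq' : 0 < q := hq
    simp only [hf, abs_of_pos hq']
    push_cast
    rw [← Complex.exp_add]
    congr 1
    ring
  have e2 : ∫ q in Set.Iic (0 : ℝ), f q = 1 / ((r : ℂ) - Complex.I * l) := by
    have h := integral_exp_mul_complex_Ioi (a := -((r : ℂ) - Complex.I * l)) (by simpa using hr) 0
    rw [Complex.ofReal_zero, mul_zero, Complex.exp_zero, neg_div_neg_eq] at h
    rw [← h, ← neg_zero, ← integral_comp_neg_Ioi, neg_zero]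
    refine setIntegral_congr_fun measurableSet_Ioi fun q hq => ?_
    have hq' : 0 < q := hq
    simp only [hf, abs_neg, abs_of_pos hq']
    push_cast
    rw [← Complex.exp_add]
    congr 1
    ring
  rw [← intervalIntegral.integral_Iic_add_Ioi (b := (0 : ℝ)) hint.integrableOn hint.integrableOn,
    e1, e2]
  have n1 : (r : ℂ) - Complex.I * l ≠ 0 := fun h => by
    have := congrArg Complex.re h; simp at this; exact hr.ne' this
  have n2 : (r : ℂ) + Complex.I * l ≠ 0 := fun h => by
    have := congrArg Complex.re h; simp at this; exact hr.ne' this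
  have e3 : ((r : ℂ) ^ 2 + (l : ℂ) ^ 2) = ((r : ℂ) - Complex.I * l) * (r + Complex.I * l) := by
    linear_combination ((l : ℂ) ^ 2) * Complex.I_sq
  push_cast
  rw [e3]
  field_simp
  ring

open scoped FourierTransform RealInnerProductSpace in
-- The Cauchy density is the Fourier transform of exp(-γ|u|) up to scaling, so inversion gives the
-- claim. Scale 0 is a Dirac mass.
lemma charFun_cauchyMeasure_zero (γ : ℝ≥0) (t : ℝ) :
    charFun (cauchyMeasure 0 γ) t = Complex.exp (-(γ * |t| : ℝ)) := by
  by_cases hγ : γ = 0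
  · subst hγ
    rw [cauchyMeasure_zero_scale, charFun_dirac]
    simp
  have hγ' : (0 : ℝ) < γ := by positivity
  set ψ : ℝ → ℂ := fun u => (Real.exp (-(γ : ℝ) * |u|) : ℂ) with hψ
  have hcont : Continuous ψ := by fun_prop
  have hint : Integrable ψ := (integrable_exp_neg_mul_abs hγ').ofReal
  have hF : 𝓕 ψ = fun w => ((2 * Real.pi * cauchyPDFReal 0 γ ((2 * Real.pi) * w) : ℝ) : ℂ) := by
    funext w
    rw [Real.fourier_eq']
    have h := integral_exp_neg_abs_mul_exp hγ' (2 * Real.pi * w)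
    have e : 2 * Real.pi * cauchyPDFReal 0 γ ((2 * Real.pi) * w)
        = 2 * γ / ((γ : ℝ) ^ 2 + (2 * Real.pi * w) ^ 2) := by
      have := Real.pi_pos
      rw [cauchyPDFReal, sub_zero, add_comm]
      field_simp
    rw [e, ← h]
    refine integral_congr_ae (ae_of_all _ fun v => ?_)
    simp only [smul_eq_mul, hψ, RCLike.inner_apply, conj_trivial]
    rw [mul_comm]
    congr 2
    push_cast
    ring
  have hFint : Integrable (𝓕 ψ) := by
    rw [hF]
    refine Integrable.ofReal (Integrable.const_mul ?_ _)
    exact (integrable_cauchyPDFReal (γ := γ) 0).comp_mul_left' (by positivity)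
  have hinv := congrFun (hcont.fourierInv_fourier_eq hint hFint) t
  rw [Real.fourierInv_eq', hF] at hinv
  have hscale := Measure.integral_comp_mul_left
    (fun x : ℝ => Complex.exp (⟪x, t⟫ * Complex.I) * (cauchyPDFReal 0 γ x : ℂ)) (2 * Real.pi)
  have e : ∫ v : ℝ, Complex.exp (((2 * Real.pi * ⟪v, t⟫ : ℝ) : ℂ) * Complex.I) •
      ((2 * Real.pi * cauchyPDFReal 0 γ ((2 * Real.pi) * v) : ℝ) : ℂ)
      = (2 * Real.pi) • ∫ x : ℝ,
        Complex.exp (⟪(2 * Real.pi) * x, t⟫ * Complex.I) * (cauchyPDFReal 0 γ ((2 * Real.pi) * x) : ℂ)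
      := by
    rw [← integral_smul]
    refine integral_congr_ae (ae_of_all _ fun v => ?_)
    simp only [RCLike.inner_apply, conj_trivial, Complex.real_smul, smul_eq_mul]
    push_cast
    rw [show (2 * (Real.pi : ℂ) * (t * v)) = t * (2 * Real.pi * v) by ring]
    ring
  rw [e, hscale, smul_smul, abs_of_pos (by positivity), mul_inv_cancel₀ (by positivity),
    one_smul] at hinv
  rw [cauchyMeasure_of_scale_ne_zero 0 hγ]
  have h2 := charFun_withDensity_ofReal (ν := (volume : Measure ℝ)) (f := cauchyPDFReal 0 γ)
    (by fun_prop) t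
  have h3 : (volume : Measure ℝ).withDensity (cauchyPDF 0 γ)
      = volume.withDensity fun x => ENNReal.ofReal (cauchyPDFReal 0 γ x) := rfl
  rw [h3, h2]
  have h4 : ∀ x, max (cauchyPDFReal 0 γ x) 0 = cauchyPDFReal 0 γ x := fun x =>
    max_eq_left (cauchyPDF_pos 0 hγ x).le
  simp_rw [h4]
  rw [hinv, hψ]
  push_cast
  congr 1
  ring

open scoped RealInnerProductSpace in
lemma charFun_map_smul_const {E : Type*} [NormedAddCommGroup E] [InnerProductSpace ℝ E]
    [MeasurableSpace E] [BorelSpace E] [SecondCountableTopology E] (μ : Measure ℝ) (v u : E) :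
    charFun (μ.map fun x => x • v) u = charFun μ ⟪v, u⟫ := by
  rw [charFun_apply, charFun_apply, integral_map (by fun_prop) (by fun_prop)]
  simp [real_inner_smul_left, mul_comm]

open scoped RealInnerProductSpace in
lemma charFun_map_stochRiemannSum {Ω E : Type*} [MeasurableSpace Ω] {P : Measure Ω}
    [NormedAddCommGroup E] [InnerProductSpace ℝ E] [MeasurableSpace E] [BorelSpace E]
    [SecondCountableTopology E] {L : ℝ → Ω → ℝ} (hL : IsCauchyMotion L P)
    {t : ℕ → ℝ} (ht : Monotone t) (φ : ℝ → E) (n : ℕ) (ξ : ℕ → ℝ) (u : E) :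
    charFun (P.map (stochRiemannSum L φ n t ξ)) u
      = Complex.exp (-(∑ k ∈ Finset.range n, (t (k + 1) - t k) * |⟪φ (ξ k), u⟫| : ℝ)) := by
  have hind : iIndepFun (fun (k : ℕ) ω => (L (t (k + 1)) ω - L (t k) ω) • φ (ξ k)) P :=
    (hL.indep.nat ht).comp (fun k x => x • φ (ξ k)) (fun k => by fun_prop)
  have hmeas : ∀ k : ℕ, AEMeasurable (fun ω => (L (t (k + 1)) ω - L (t k) ω) • φ (ξ k)) P :=
    fun k => (hL.law (t k) (t (k + 1))).aemeasurable.smul_const _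
  have h1 : stochRiemannSum L φ n t ξ
      = fun ω => ∑ k ∈ Finset.range n, (L (t (k + 1)) ω - L (t k) ω) • φ (ξ k) := rfl
  rw [h1, (hind.restrict (Finset.range n)).charFun_map_fun_finsetSum_eq_prod
    (fun k _ => hmeas k), Finset.prod_apply, Complex.ofReal_sum, ← Finset.sum_neg_distrib,
    Complex.exp_sum]
  refine Finset.prod_congr rfl fun k _ => ?_
  have h2 : P.map (fun ω => (L (t (k + 1)) ω - L (t k) ω) • φ (ξ k))
      = (cauchyMeasure 0 (Real.nnabs (t (k + 1) - t k))).map fun x => x • φ (ξ k) := by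
    rw [← (hL.law (t k) (t (k + 1))).map_eq, AEMeasurable.map_map_of_aemeasurable (by fun_prop)
      (hL.law (t k) (t (k + 1))).aemeasurable]
    rfl
  rw [h2, charFun_map_smul_const, charFun_cauchyMeasure_zero, Real.coe_nnabs,
    abs_of_nonneg (sub_nonneg.2 (ht k.le_succ))]

open scoped RealInnerProductSpace in
-- A subsequence converges almost everywhere, and dominated convergence passes the common value c to
-- the limit.
lemma tendsto_charFun_of_tendstoInMeasure {Ω E : Type*} [MeasurableSpace Ω] {P : Measure Ω}
    [IsFiniteMeasure P] [NormedAddCommGroup E] [InnerProductSpace ℝ E] [MeasurableSpace E]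
    [BorelSpace E] [SecondCountableTopology E] {X : ℕ → Ω → E} {Z : Ω → E}
    (hX : ∀ m, AEMeasurable (X m) P) (hZ : AEMeasurable Z P) (h : TendstoInMeasure P X atTop Z)
    (u : E) {c : ℂ} (hc : ∀ m, charFun (P.map (X m)) u = c) : charFun (P.map Z) u = c := by
  obtain ⟨ns, -, hns⟩ := h.exists_seq_tendsto_ae
  have e : ∀ {Y : Ω → E}, AEMeasurable Y P →
      charFun (P.map Y) u = ∫ ω, Complex.exp (⟪Y ω, u⟫ * Complex.I) ∂P := by
    intro Y hY
    rw [charFun_apply, integral_map hY (by fun_prop)]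
  have hlim : Tendsto (fun m => ∫ ω, Complex.exp (⟪X (ns m) ω, u⟫ * Complex.I) ∂P) atTop
      (𝓝 (∫ ω, Complex.exp (⟪Z ω, u⟫ * Complex.I) ∂P)) := by
    refine tendsto_integral_of_dominated_convergence (fun _ => 1) (fun m => ?_)
      (integrable_const _) (fun m => ae_of_all _ fun ω => ?_) ?_
    · have : Measurable fun x : E => Complex.exp (⟪x, u⟫ * Complex.I) := by fun_prop
      exact (this.comp_aemeasurable (hX (ns m))).aestronglyMeasurable
    · rw [Complex.norm_exp_ofReal_mul_I]
    · filter_upwards [hns] with ω hω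
      have : Continuous fun x : E => Complex.exp (⟪x, u⟫ * Complex.I) := by fun_prop
      exact (this.tendsto (Z ω)).comp hω
  simp_rw [fun m => (e (hX (ns m))).symm.trans (hc (ns m))] at hlim
  rw [e hZ]
  exact tendsto_nhds_unique hlim tendsto_const_nhds

open scoped RealInnerProductSpace in
lemma charFun_map_stochIntegral_oneX {Ω : Type*} [MeasurableSpace Ω] {P : Measure Ω}
    [IsProbabilityMeasure P] {L : ℝ → Ω → ℝ} {Z : Ω → EuclideanSpace ℝ (Fin 2)}
    (hL : IsCauchyMotion L P) (hZ : IsStochIntegral L P oneX 0 1 Z)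
    (u : EuclideanSpace ℝ (Fin 2)) :
    charFun (P.map Z) u = Complex.exp (-ciExponent (u 0) (u 1)) := by
  have hinner : ∀ x : ℝ, ⟪oneX x, u⟫ = u 0 + u 1 * x := by
    intro x
    simp [oneX, PiLp.inner_apply, Fin.sum_univ_two]
  have hcont : Continuous fun x : ℝ => |u 0 + u 1 * x| := by fun_prop
  set t : ℕ → ℕ → ℝ := fun m k => k / (m + 1) with ht
  have hstep : ∀ m k : ℕ, t m (k + 1) - t m k = 1 / (m + 1) := by
    intro m k
    simp only [ht]
    push_cast
    ring
  have hlt : ∀ m k : ℕ, t m k < t m (k + 1) := fun m k => by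
    have := hstep m k
    have h2 : (0 : ℝ) < 1 / (m + 1) := by positivity
    linarith
  -- The tags come from the mean value theorem for integrals and may depend on u. With them every
  -- Riemann sum already has exactly the limiting characteristic function.
  have hex : ∀ m k : ℕ, ∃ c ∈ Set.Icc (t m k) (t m (k + 1)),
      (t m (k + 1) - t m k) * |u 0 + u 1 * c| = ∫ x in t m k..t m (k + 1), |u 0 + u 1 * x| := by
    intro m k
    obtain ⟨c, hc, he⟩ := exists_eq_interval_average (f := fun x : ℝ => |u 0 + u 1 * x|)
      (hlt m k).ne hcont.continuousOn
    rw [Set.uIoo_of_lt (hlt m k)] at hc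
    refine ⟨c, Set.Ioo_subset_Icc_self hc, ?_⟩
    rw [he, interval_average_eq, smul_eq_mul,
      mul_inv_cancel_left₀ (sub_pos.2 (hlt m k)).ne']
  choose ξ hξ hξe using hex
  have hmono : ∀ m, Monotone (t m) := fun m => monotone_nat_of_le_succ fun k => (hlt m k).le
  have hconv := hZ.2 (fun m => 1 / ((m : ℝ) + 1)) (fun m => m + 1) t ξ
    tendsto_one_div_add_atTop_nhds_zero_nat (fun m =>
      { left := by simp [ht]
        right := by simp only [ht]; push_cast; exact div_self (by positivity)
        mono := fun k _ => (hlt m k).le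
        tag := fun k _ => hξ m k
        mesh := fun k _ => (hstep m k).le })
  refine tendsto_charFun_of_tendstoInMeasure (fun m => ?_) hZ.1 hconv u fun m => ?_
  · have h1 : stochRiemannSum L oneX (m + 1) (t m) (ξ m)
        = fun ω => ∑ k ∈ Finset.range (m + 1),
          (L (t m (k + 1)) ω - L (t m k) ω) • oneX (ξ m k) := rfl
    rw [h1]
    exact Finset.aemeasurable_fun_sum _ fun k _ =>
      (hL.law (t m k) (t m (k + 1))).aemeasurable.smul_const _
  · rw [charFun_map_stochRiemannSum hL (hmono m)]
    simp_rw [hinner, hξe]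
    rw [intervalIntegral.sum_integral_adjacent_intervals
      fun k _ => hcont.intervalIntegrable _ _]
    have e0 : t m 0 = 0 := by simp [ht]
    have e1 : t m (m + 1) = 1 := by simp only [ht]; push_cast; exact div_self (by positivity)
    rw [e0, e1]
    rfl

/-- `CI₁(0, 1)` has density `ciDensity`. -/
lemma map_stochIntegral_oneX {Ω : Type*} [MeasurableSpace Ω] {P : Measure Ω}
    [IsProbabilityMeasure P] {L : ℝ → Ω → ℝ} {Z : Ω → EuclideanSpace ℝ (Fin 2)}
    (hL : IsCauchyMotion L P) (hZ : IsStochIntegral L P oneX 0 1 Z) :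
    P.map Z = volume.withDensity fun x => ENNReal.ofReal (ciDensity x) := by
  have : IsProbabilityMeasure (P.map Z) := Measure.isProbabilityMeasure_map hZ.1
  refine eq_withDensity_of_charFun measurable_ciDensity integrable_ciDensity fun u => ?_
  rw [charFun_map_stochIntegral_oneX hL hZ, integral_exp_inner_mul_ciDensity]

/-! ### The total mass of the density -/

/-- The integrand is |b|-Lipschitz, so each of the m + 1 cells contributes an error of at most
|b|/(m + 1)². -/
lemma tendsto_riemannSum_ciExponent (a b : ℝ) :
    Tendsto (fun m : ℕ => ∑ k ∈ Finset.range (m + 1), 1 / ((m : ℝ) + 1) * |a + b * (k / (m + 1))|)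
      atTop (𝓝 (ciExponent a b)) := by
  have hcont : Continuous fun x : ℝ => |a + b * x| := by fun_prop
  have hlim : Tendsto (fun m : ℕ => |b| * (1 / ((m : ℝ) + 1))) atTop (𝓝 0) := by
    simpa using tendsto_one_div_add_atTop_nhds_zero_nat.const_mul |b|
  rw [tendsto_iff_dist_tendsto_zero]
  refine squeeze_zero (fun _ => dist_nonneg) (fun m => ?_) hlim
  set t : ℕ → ℝ := fun k => k / ((m : ℝ) + 1) with ht
  have hm : (0 : ℝ) < 1 / ((m : ℝ) + 1) := by positivity
  have hstep : ∀ k : ℕ, t (k + 1) - t k = 1 / ((m : ℝ) + 1) := by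
    intro k
    simp only [ht]
    push_cast
    ring
  have e0 : t 0 = 0 := by simp [ht]
  have e1 : t (m + 1) = 1 := by simp only [ht]; push_cast; exact div_self (by positivity)
  have hE : ciExponent a b = ∑ k ∈ Finset.range (m + 1), ∫ x in t k..t (k + 1), |a + b * x| := by
    rw [intervalIntegral.sum_integral_adjacent_intervals
      fun k _ => hcont.intervalIntegrable _ _, e0, e1]
    rfl
  rw [hE, Real.dist_eq, ← Finset.sum_sub_distrib]
  calc abs (∑ k ∈ Finset.range (m + 1), (1 / ((m : ℝ) + 1) * |a + b * t k|
          - ∫ x in t k..t (k + 1), |a + b * x|))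
      ≤ ∑ k ∈ Finset.range (m + 1), abs (1 / ((m : ℝ) + 1) * |a + b * t k|
          - ∫ x in t k..t (k + 1), |a + b * x|) := Finset.abs_sum_le_sum_abs _ _
    _ ≤ ∑ _k ∈ Finset.range (m + 1), |b| * (1 / ((m : ℝ) + 1)) * (1 / ((m : ℝ) + 1)) := by
        refine Finset.sum_le_sum fun k _ => ?_
        have h1 : 1 / ((m : ℝ) + 1) * |a + b * t k| = ∫ _x in t k..t (k + 1), |a + b * t k| := by
          rw [intervalIntegral.integral_const, hstep, smul_eq_mul]
        rw [h1, ← intervalIntegral.integral_sub intervalIntegrable_const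
          (hcont.intervalIntegrable _ _), ← Real.norm_eq_abs]
        refine (intervalIntegral.norm_integral_le_of_norm_le_const
          (C := |b| * (1 / ((m : ℝ) + 1))) fun x hx => ?_).trans_eq ?_
        · rw [Set.uIoc_of_le (by linarith [hstep k])] at hx
          rw [Real.norm_eq_abs]
          refine (abs_abs_sub_abs_le _ _).trans ?_
          rw [show a + b * t k - (a + b * x) = b * (t k - x) by ring, abs_mul]
          refine mul_le_mul_of_nonneg_left ?_ (abs_nonneg b)
          rw [abs_le]
          constructor <;> linarith [hx.1, hx.2, hstep k]
        · rw [hstep, abs_of_pos hm]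
    _ = |b| * (1 / ((m : ℝ) + 1)) := by
        rw [Finset.sum_const, Finset.card_range, nsmul_eq_mul]
        push_cast
        field_simp

/-- A pointwise limit of characteristic functions that is continuous at `0` is the characteristic
function of a probability measure. -/
lemma exists_charFun_eq_of_tendsto {E : Type*} [NormedAddCommGroup E] [InnerProductSpace ℝ E]
    [FiniteDimensional ℝ E] [MeasurableSpace E] [BorelSpace E] (μ : ℕ → ProbabilityMeasure E)
    {f : E → ℂ} (hf : ContinuousAt f 0)
    (h : ∀ u, Tendsto (fun n => charFun (μ n : Measure E) u) atTop (𝓝 (f u))) :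
    ∃ μ' : ProbabilityMeasure E, ∀ u, charFun (μ' : Measure E) u = f u := by
  have h_tight := isTightMeasureSet_of_tendsto_charFun (μ := fun n => (μ n : Measure E)) hf h
  have h_compact : IsCompact (closure {μ n | n}) := by
    apply isCompact_closure_of_isTightMeasureSet
    convert h_tight using 1
    ext ν
    simp
  -- Tightness makes the closure compact; a limit along an ultrafilter finer than `atTop` suffices,
  -- since the characteristic functions converge along it too.
  let U : Ultrafilter ℕ := Ultrafilter.of atTop
  have hU : (U : Filter ℕ) ≤ atTop := Ultrafilter.of_le atTop
  obtain ⟨μ', -, hμ' : Tendsto _ _ _⟩ := h_compact.ultrafilter_le_nhds (U.map μ)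
    (.trans (by simp) (monotone_principal subset_closure))
  refine ⟨μ', fun u => ?_⟩
  rw [ProbabilityMeasure.tendsto_iff_forall_integral_rclike_tendsto ℂ] at hμ'
  have h1 := hμ' (BoundedContinuousFunction.innerProbChar u)
  simp_rw [← charFun_eq_integral_innerProbChar] at h1
  exact tendsto_nhds_unique h1 ((h u).comp hU)

open scoped RealInnerProductSpace in
-- The approximants are sums of independent Cauchy multiples of (1, k/(m + 1)), the laws of
-- left-tagged Riemann sums. Only a probability measure is needed here, not the process.
lemma exists_charFun_eq_exp_neg_ciExponent :
    ∃ μ : ProbabilityMeasure (EuclideanSpace ℝ (Fin 2)), ∀ u,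
      charFun (μ : Measure (EuclideanSpace ℝ (Fin 2))) u
        = Complex.exp (-ciExponent (u 0) (u 1)) := by
  let ν (m : ℕ) (k : Fin (m + 1)) : Measure (EuclideanSpace ℝ (Fin 2)) :=
    (cauchyMeasure 0 (1 / ((m : ℝ≥0) + 1))).map fun x => x • oneX (k / ((m : ℝ) + 1))
  have hν (m : ℕ) (k : Fin (m + 1)) : IsProbabilityMeasure (ν m k) :=
    Measure.isProbabilityMeasure_map (by fun_prop)
  let μ (m : ℕ) : ProbabilityMeasure (EuclideanSpace ℝ (Fin 2)) :=
    ⟨(Measure.pi (ν m)).map fun p => ∑ i, p i, Measure.isProbabilityMeasure_map (by fun_prop)⟩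
  have hinner : ∀ (x : ℝ) (u : EuclideanSpace ℝ (Fin 2)), ⟪oneX x, u⟫ = u 0 + u 1 * x := by
    intro x u
    simp [oneX, PiLp.inner_apply, Fin.sum_univ_two]
  refine exists_charFun_eq_of_tendsto μ (Continuous.continuousAt ?_) fun u => ?_
  · have h2 : Continuous fun u : EuclideanSpace ℝ (Fin 2) => ciExponent (u 0) (u 1) :=
      continuous_ciExponent.comp (by fun_prop : Continuous fun u : EuclideanSpace ℝ (Fin 2) =>
        (u 0, u 1))
    fun_prop
  · have hc : ∀ m, charFun (μ m : Measure (EuclideanSpace ℝ (Fin 2))) u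
        = Complex.exp (-((∑ k ∈ Finset.range (m + 1),
          1 / ((m : ℝ) + 1) * |u 0 + u 1 * (k / (m + 1))| : ℝ) : ℂ)) := by
      intro m
      simp only [μ, ProbabilityMeasure.coe_mk]
      rw [charFun_map_sum_pi_eq_prod, Finset.prod_apply]
      simp only [ν]
      simp_rw [charFun_map_smul_const, charFun_cauchyMeasure_zero, hinner]
      rw [← Complex.exp_sum, Finset.sum_range]
      push_cast
      rw [Finset.sum_neg_distrib]
    simp_rw [hc]
    have := tendsto_riemannSum_ciExponent (u 0) (u 1)
    exact (Complex.continuous_exp.tendsto _).comp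
      ((Complex.continuous_ofReal.tendsto _).comp this).neg

lemma lintegral_ciDensity :
    ∫⁻ x : EuclideanSpace ℝ (Fin 2), ENNReal.ofReal (ciDensity x) = 1 := by
  obtain ⟨μ, hμ⟩ := exists_charFun_eq_exp_neg_ciExponent
  have h := eq_withDensity_of_charFun (μ := (μ : Measure (EuclideanSpace ℝ (Fin 2))))
    measurable_ciDensity integrable_ciDensity
    fun u => by rw [hμ, integral_exp_inner_mul_ciDensity]
  have h1 : (μ : Measure (EuclideanSpace ℝ (Fin 2))) Set.univ = 1 := measure_univ
  rwa [h, withDensity_apply _ MeasurableSet.univ, Measure.restrict_univ] at h1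

/-! ### The first visit of an i.i.d. sequence to a set -/

section FirstHit

variable {E : Type*} {S A : Set E}

/-- The first index at which the sequence `x` is in `S` (`0` if there is none). -/
noncomputable def firstHit (S : Set E) (x : ℕ → E) : ℕ := sInf {m | x m ∈ S}

lemma firstHit_eq {x : ℕ → E} {m : ℕ} (h : ∀ k < m, x k ∉ S) (hm : x m ∈ S) :
    firstHit S x = m := by
  refine le_antisymm (Nat.sInf_le hm) ?_
  by_contra! hlt
  exact h _ hlt (Nat.sInf_mem (s := {m | x m ∈ S}) ⟨m, hm⟩)

lemma firstHit_mem {x : ℕ → E} (h : ∃ m, x m ∈ S) : x (firstHit S x) ∈ S :=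
  Nat.sInf_mem (s := {m | x m ∈ S}) h

lemma notMem_of_lt_firstHit {x : ℕ → E} {k : ℕ} (h : k < firstHit S x) : x k ∉ S :=
  Nat.notMem_of_lt_sInf (s := {m | x m ∈ S}) h

open Classical in
-- The number of trials up to the first success is the number of m for which the first m trials all
-- fail; both sides are ∞ without a success.
lemma firstHit_add_one_eq_tsum (S : Set E) (x : ℕ → E) :
    (if ∃ m, x m ∈ S then (firstHit S x : ℝ≥0∞) + 1 else ∞)
      = ∑' m : ℕ, {x : ℕ → E | ∀ k < m, x k ∉ S}.indicator 1 x := by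
  split_ifs with h
  · rw [tsum_eq_sum (s := Finset.range (firstHit S x + 1))]
    · rw [Finset.sum_congr rfl fun m hm => Set.indicator_of_mem (by
        intro k hk
        exact notMem_of_lt_firstHit (by have := Finset.mem_range.1 hm; omega)) _]
      simp
    · intro m hm
      refine Set.indicator_of_notMem (fun hx => ?_) _
      exact hx _ (by simpa using hm) (firstHit_mem h)
  · push Not at h
    have : ∀ m : ℕ, {x : ℕ → E | ∀ k < m, x k ∉ S}.indicator (1 : (ℕ → E) → ℝ≥0∞) x = 1 :=
      fun m => Set.indicator_of_mem (show x ∈ {x : ℕ → E | ∀ k < m, x k ∉ S} from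
        fun k _ => h k) _
    simp_rw [this]
    exact (ENNReal.tsum_const_eq_top_of_ne_zero one_ne_zero).symm

variable [MeasurableSpace E]

lemma measurableSet_avoid (hS : MeasurableSet S) (m : ℕ) :
    MeasurableSet {x : ℕ → E | ∀ k < m, x k ∉ S} := by
  have : {x : ℕ → E | ∀ k < m, x k ∉ S} = ⋂ k, ⋂ (_ : k < m), (fun x => x k) ⁻¹' Sᶜ := by
    ext x; simp
  rw [this]
  exact MeasurableSet.iInter fun k => MeasurableSet.iInter fun _ =>
    (measurable_pi_apply k) hS.compl

lemma measurableSet_avoid_and (hS : MeasurableSet S) (hA : MeasurableSet A) (m : ℕ) :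
    MeasurableSet {x : ℕ → E | (∀ k < m, x k ∉ S) ∧ x m ∈ A} :=
  (measurableSet_avoid hS m).inter ((measurable_pi_apply m) hA)

lemma infinitePi_avoid_and (ν : Measure E) [IsProbabilityMeasure ν] (hS : MeasurableSet S) (hA : MeasurableSet A) (m : ℕ) :
    Measure.infinitePi (fun _ : ℕ => ν) {x | (∀ k < m, x k ∉ S) ∧ x m ∈ A}
      = ν Sᶜ ^ m * ν A := by
  have : {x : ℕ → E | (∀ k < m, x k ∉ S) ∧ x m ∈ A}
      = Set.pi (Finset.range (m + 1) : Finset ℕ) fun k => if k < m then Sᶜ else A := by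
    ext x
    simp only [Set.mem_ofPred_eq, Set.mem_pi, Finset.coe_range, Set.mem_Iio]
    constructor
    · rintro ⟨h1, h2⟩ k hk
      split_ifs with h
      · exact h1 k h
      · rwa [show k = m by omega]
    · intro h
      refine ⟨fun k hk => ?_, ?_⟩
      · have := h k (by omega)
        rwa [if_pos hk] at this
      · have := h m (by omega)
        rwa [if_neg (lt_irrefl m)] at this
  rw [this, Measure.infinitePi_pi, Finset.prod_range_succ, if_neg (lt_irrefl m)]
  · congr 1
    rw [Finset.prod_congr rfl fun k hk => by rw [if_pos (Finset.mem_range.1 hk)]]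
    simp
  · intro k _
    split_ifs
    exacts [hS.compl, hA]

lemma infinitePi_avoid (ν : Measure E) [IsProbabilityMeasure ν] (hS : MeasurableSet S) (m : ℕ) :
    Measure.infinitePi (fun _ : ℕ => ν) {x | ∀ k < m, x k ∉ S} = ν Sᶜ ^ m := by
  simpa using infinitePi_avoid_and ν hS MeasurableSet.univ m

lemma tsum_prob_compl_pow (ν : Measure E) [IsProbabilityMeasure ν] (hS : MeasurableSet S) : ∑' m : ℕ, ν Sᶜ ^ m = (ν S)⁻¹ := by
  rw [ENNReal.tsum_geometric, prob_compl_eq_one_sub hS,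
    ENNReal.sub_sub_cancel ENNReal.one_ne_top prob_le_one]

lemma ae_exists_mem (ν : Measure E) [IsProbabilityMeasure ν] (hS : MeasurableSet S) (h0 : ν S ≠ 0) :
    ∀ᵐ x ∂Measure.infinitePi (fun _ : ℕ => ν), ∃ m, x m ∈ S := by
  rw [ae_iff]
  have hlt : ν Sᶜ < 1 := by
    rw [prob_compl_eq_one_sub hS]
    exact ENNReal.sub_lt_self ENNReal.one_ne_top one_ne_zero h0
  refine le_antisymm (ge_of_tendsto' (ENNReal.tendsto_pow_atTop_nhds_zero_of_lt_one hlt)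
    fun m => ?_) bot_le
  rw [← infinitePi_avoid ν hS]
  refine measure_mono fun x hx k _ hk => hx ⟨k, hk⟩

/-- The event that S is never visited is treated separately: there the default index 0 selects `x
0`. -/
lemma measurable_apply_firstHit (hS : MeasurableSet S) :
    Measurable fun x : ℕ → E => x (firstHit S x) := by
  intro A hA
  have : (fun x : ℕ → E => x (firstHit S x)) ⁻¹' A
      = (⋃ m, {x | (∀ k < m, x k ∉ S) ∧ x m ∈ S ∩ A}) ∪
        ((⋂ m, {x | ∀ k < m, x k ∉ S}) ∩ (fun x => x 0) ⁻¹' A) := by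
    ext x
    simp only [Set.mem_preimage, Set.mem_union, Set.mem_iUnion, Set.mem_ofPred_eq, Set.mem_inter_iff,
      Set.mem_iInter]
    constructor
    · intro hx
      by_cases h : ∃ m, x m ∈ S
      · exact Or.inl ⟨_, fun k hk => notMem_of_lt_firstHit hk, firstHit_mem h, hx⟩
      · push Not at h
        refine Or.inr ⟨fun m k _ => h k, ?_⟩
        have : firstHit S x = 0 := by
          simp [firstHit, h]
        rwa [this] at hx
    · rintro (⟨m, h1, h2, h3⟩ | ⟨h1, h2⟩)
      · rwa [firstHit_eq h1 h2]
      · have : firstHit S x = 0 := by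
          have : ∀ k, x k ∉ S := fun k => h1 (k + 1) k (Nat.lt_succ_self k)
          simp [firstHit, this]
        rwa [this]
  rw [this]
  exact (MeasurableSet.iUnion fun m => measurableSet_avoid_and hS (hS.inter hA) m).union
    ((MeasurableSet.iInter fun m => measurableSet_avoid hS m).inter ((measurable_pi_apply 0) hA))

/-- The first term in `S` of an i.i.d. sequence has the conditional law given `S`. -/
lemma map_apply_firstHit (ν : Measure E) [IsProbabilityMeasure ν] (hS : MeasurableSet S) (h0 : ν S ≠ 0) :
    (Measure.infinitePi fun _ : ℕ => ν).map (fun x => x (firstHit S x)) = ν[|S] := by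
  ext A hA
  rw [Measure.map_apply (measurable_apply_firstHit hS) hA, cond_apply hS]
  have : (fun x : ℕ → E => x (firstHit S x)) ⁻¹' A =ᵐ[Measure.infinitePi fun _ : ℕ => ν]
      ⋃ m, {x | (∀ k < m, x k ∉ S) ∧ x m ∈ S ∩ A} := by
    filter_upwards [ae_exists_mem ν hS h0] with x hx
    refine propext (Iff.trans ?_ Set.mem_iUnion.symm)
    constructor
    · exact fun h => ⟨_, fun k hk => notMem_of_lt_firstHit hk, firstHit_mem hx, h⟩
    · rintro ⟨m, h1, h2, h3⟩
      change x (firstHit S x) ∈ A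
      rwa [firstHit_eq h1 h2]
  -- Summing ν(Sᶜ)^m ν(S ∩ A) over the hitting time is a geometric series with value ν(S ∩ A)/ν(S).
  rw [measure_congr this, measure_iUnion]
  · simp_rw [infinitePi_avoid_and ν hS (hS.inter hA)]
    rw [ENNReal.tsum_mul_right, tsum_prob_compl_pow ν hS]
  · intro m n hmn
    refine Set.disjoint_left.2 fun x hx hx' => hmn ?_
    rw [← firstHit_eq hx.1 hx.2.1, firstHit_eq hx'.1 hx'.2.1]
  · exact fun m => measurableSet_avoid_and hS (hS.inter hA) m

open Classical in
lemma measurable_firstHit_add_one (hS : MeasurableSet S) :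
    Measurable fun x : ℕ → E => if ∃ m, x m ∈ S then (firstHit S x : ℝ≥0∞) + 1 else ∞ := by
  simp_rw [firstHit_add_one_eq_tsum]
  exact Measurable.tsum fun m => measurable_one.indicator (measurableSet_avoid hS m)

open Classical in
lemma lintegral_firstHit_add_one (ν : Measure E) [IsProbabilityMeasure ν] (hS : MeasurableSet S) :
    ∫⁻ x, (if ∃ m, x m ∈ S then (firstHit S x : ℝ≥0∞) + 1 else ∞)
      ∂Measure.infinitePi (fun _ : ℕ => ν) = (ν S)⁻¹ := by
  simp_rw [firstHit_add_one_eq_tsum]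
  rw [lintegral_tsum fun m =>
    (measurable_one.indicator (measurableSet_avoid hS m)).aemeasurable]
  simp_rw [lintegral_indicator_one (measurableSet_avoid hS _), infinitePi_avoid ν hS]
  exact tsum_prob_compl_pow ν hS

end FirstHit

/-! ### The rejection sampler -/

instance isProbabilityMeasure_chiSqOne : IsProbabilityMeasure chiSqOne :=
  Measure.isProbabilityMeasure_map (by fun_prop)

/-- The laws of the samples `y₁, y₂, w, v₁, v₂` that one round of the sampler draws. -/
noncomputable def roundSource : Fin 5 → Measure ℝ :=
  ![gaussianReal 0 1, gaussianReal 0 1, chiSqOne, gaussianReal 0 1, gaussianReal 0 1]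

instance isProbabilityMeasure_roundSource (j : Fin 5) : IsProbabilityMeasure (roundSource j) := by
  fin_cases j <;> simp only [roundSource] <;> first
    | exact instIsProbabilityMeasureGaussianReal 0 1
    | exact isProbabilityMeasure_chiSqOne

/-- The joint law of the samples that one round of the sampler draws. -/
noncomputable def roundLaw : Measure (Fin 5 → ℝ) := Measure.infinitePi roundSource

instance isProbabilityMeasure_roundLaw : IsProbabilityMeasure roundLaw := by
  unfold roundLaw; infer_instance

/-- The proposal made from the samples of one round. -/
noncomputable def roundProposal (e : Fin 5 → ℝ) : EuclideanSpace ℝ (Fin 2) :=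
  studentProposal (e 0) (e 1) (e 2)

/-- The samples with which a round accepts. -/
def roundAccept : Set (Fin 5 → ℝ) :=
  {e | Real.exp (-(e 3 ^ 2 + e 4 ^ 2) / 2) * (25 / Real.pi * studentDensity (roundProposal e))
    ≤ ciDensity (roundProposal e)}

lemma measurable_roundProposal : Measurable roundProposal :=
  measurable_studentProposal.comp
    (by fun_prop : Measurable fun e : Fin 5 → ℝ => (e 0, e 1, e 2))

lemma measurableSet_roundAccept : MeasurableSet roundAccept := by
  have h1 := measurable_studentDensity.comp measurable_roundProposal
  have h2 := measurable_ciDensity.comp measurable_roundProposal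
  refine measurableSet_le (Measurable.mul (by fun_prop) ?_) h2
  exact h1.const_mul _

lemma measurable_vecFive : Measurable fun p : ℝ × ℝ × ℝ × ℝ × ℝ =>
    ![p.1, p.2.1, p.2.2.1, p.2.2.2.1, p.2.2.2.2] := by
  refine measurable_pi_iff.2 fun j => ?_
  fin_cases j <;> simp <;> fun_prop

lemma roundLaw_eq_map : roundLaw =
    ((gaussianReal 0 1).prod ((gaussianReal 0 1).prod (chiSqOne.prod
      ((gaussianReal 0 1).prod (gaussianReal 0 1))))).map
      fun p => ![p.1, p.2.1, p.2.2.1, p.2.2.2.1, p.2.2.2.2] := by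
  rw [roundLaw, Measure.infinitePi_eq_pi]
  refine Measure.pi_eq fun s hs => ?_
  have hm := measurable_vecFive
  rw [Measure.map_apply hm (MeasurableSet.univ_pi hs)]
  have : (fun p : ℝ × ℝ × ℝ × ℝ × ℝ => ![p.1, p.2.1, p.2.2.1, p.2.2.2.1, p.2.2.2.2]) ⁻¹'
      Set.univ.pi s = s 0 ×ˢ s 1 ×ˢ s 2 ×ˢ s 3 ×ˢ s 4 := by
    ext p
    simp [Fin.forall_fin_succ, Set.mem_prod]
  rw [this]
  simp only [Measure.prod_prod, Fin.prod_univ_five, roundSource]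
  simp [mul_assoc]

lemma lintegral_roundLaw {F : (Fin 5 → ℝ) → ℝ≥0∞} (hF : Measurable F) :
    ∫⁻ e, F e ∂roundLaw = ∫⁻ y₁, ∫⁻ y₂, ∫⁻ w, ∫⁻ v₁, ∫⁻ v₂, F ![y₁, y₂, w, v₁, v₂]
      ∂gaussianReal 0 1 ∂gaussianReal 0 1 ∂chiSqOne ∂gaussianReal 0 1 ∂gaussianReal 0 1 := by
  have hm := measurable_vecFive
  have hFm : Measurable fun p : ℝ × ℝ × ℝ × ℝ × ℝ =>
      F ![p.1, p.2.1, p.2.2.1, p.2.2.2.1, p.2.2.2.2] := hF.comp hm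
  rw [roundLaw_eq_map, lintegral_map hF hm, lintegral_prod _ hFm.aemeasurable]
  refine lintegral_congr fun y₁ => ?_
  have h1 := hFm.comp (measurable_prodMk_left (x := y₁))
  refine (lintegral_prod _ h1.aemeasurable).trans (lintegral_congr fun y₂ => ?_)
  have h2 := h1.comp (measurable_prodMk_left (x := y₂))
  refine (lintegral_prod _ h2.aemeasurable).trans (lintegral_congr fun w => ?_)
  have h3 := h2.comp (measurable_prodMk_left (x := w))
  exact lintegral_prod _ h3.aemeasurable

lemma studentDensity_pos (x : EuclideanSpace ℝ (Fin 2)) : 0 < studentDensity x := by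
  have := Real.pi_pos
  unfold studentDensity
  positivity

/-- Integrating out v₁, v₂ first leaves the acceptance probability f/((25/π) g), at most 1 by the
envelope. Integrating it against the proposal density cancels g. -/
lemma roundLaw_accept_inter {A : Set (EuclideanSpace ℝ (Fin 2))} (hA : MeasurableSet A) :
    roundLaw (roundAccept ∩ roundProposal ⁻¹' A)
      = ENNReal.ofReal (Real.pi / 25) * ∫⁻ x in A, ENNReal.ofReal (ciDensity x) := by
  have hpi := Real.pi_pos
  have hm := measurableSet_roundAccept.inter (measurable_roundProposal hA)
  set c : EuclideanSpace ℝ (Fin 2) → ℝ := fun x =>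
    ciDensity x / (25 / Real.pi * studentDensity x) with hc
  have hpos : ∀ x, 0 < 25 / Real.pi * studentDensity x := fun x =>
    mul_pos (by positivity) (studentDensity_pos x)
  have hc1 : ∀ x, c x ≤ 1 := fun x =>
    (div_le_one (hpos x)).2 ((le_abs_self _).trans (abs_ciDensity_le x))
  have hcm : Measurable c := measurable_ciDensity.div (measurable_studentDensity.const_mul _)
  set φ : EuclideanSpace ℝ (Fin 2) → ℝ≥0∞ := A.indicator fun x => ENNReal.ofReal (c x) with hφ
  have hφm : Measurable φ := hcm.ennreal_ofReal.indicator hA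
  rw [← lintegral_indicator_one hm, lintegral_roundLaw (measurable_one.indicator hm)]
  calc _ = ∫⁻ y₁, ∫⁻ y₂, ∫⁻ w, φ (studentProposal y₁ y₂ w)
      ∂chiSqOne ∂gaussianReal 0 1 ∂gaussianReal 0 1 := by
        refine lintegral_congr fun y₁ => lintegral_congr fun y₂ => lintegral_congr fun w => ?_
        by_cases hx : studentProposal y₁ y₂ w ∈ A
        · rw [hφ, Set.indicator_of_mem hx, ← lintegral_exp_gaussian_le (hc1 _)]
          refine lintegral_congr fun v₁ => lintegral_congr fun v₂ => ?_
          classical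
          rw [Set.indicator_apply]
          simp only [Pi.one_apply, hc, le_div_iff₀ (hpos _)]
          refine if_congr ?_ rfl rfl
          exact ⟨fun h => h.1, fun h => ⟨h, hx⟩⟩
        · rw [hφ, Set.indicator_of_notMem hx]
          have : ∀ v₁ v₂ : ℝ, (roundAccept ∩ roundProposal ⁻¹' A).indicator
              (1 : (Fin 5 → ℝ) → ℝ≥0∞) ![y₁, y₂, w, v₁, v₂] = 0 :=
            fun v₁ v₂ => Set.indicator_of_notMem (fun h => hx h.2) _
          simp [this]
    _ = ∫⁻ x, ENNReal.ofReal (studentDensity x) * φ x := lintegral_studentProposal hφm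
    _ = ∫⁻ x in A, ENNReal.ofReal (Real.pi / 25) * ENNReal.ofReal (ciDensity x) := by
        rw [← lintegral_indicator hA]
        refine lintegral_congr fun x => ?_
        by_cases hx : x ∈ A
        · rw [hφ, Set.indicator_of_mem hx, Set.indicator_of_mem hx,
            ← ENNReal.ofReal_mul (studentDensity_nonneg x), ← ENNReal.ofReal_mul (by positivity)]
          congr 1
          have := studentDensity_pos x
          simp only [hc]
          field_simp
        · rw [hφ, Set.indicator_of_notMem hx, Set.indicator_of_notMem hx, mul_zero]
    _ = _ := lintegral_const_mul _ measurable_ciDensity.ennreal_ofReal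

lemma roundLaw_accept : roundLaw roundAccept = ENNReal.ofReal (Real.pi / 25) := by
  have := roundLaw_accept_inter MeasurableSet.univ
  rwa [Set.preimage_univ, Set.inter_univ, Measure.restrict_univ, lintegral_ciDensity,
    mul_one] at this

/-- Given that a round accepts, its proposal has density `ciDensity`. -/
lemma map_roundProposal_cond : (roundLaw[|roundAccept]).map roundProposal
    = volume.withDensity fun x => ENNReal.ofReal (ciDensity x) := by
  ext A hA
  rw [Measure.map_apply measurable_roundProposal hA, cond_apply measurableSet_roundAccept,
    roundLaw_accept_inter hA, roundLaw_accept, withDensity_apply _ hA, ← mul_assoc,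
    ENNReal.inv_mul_cancel, one_mul]
  · have := Real.pi_pos
    simpa using by positivity
  · exact ENNReal.ofReal_ne_top

lemma map_roundProposal : roundLaw.map roundProposal
    = volume.withDensity fun x => ENNReal.ofReal (studentDensity x) := by
  ext A hA
  rw [Measure.map_apply measurable_roundProposal hA, withDensity_apply _ hA,
    ← lintegral_indicator_one (measurable_roundProposal hA),
    lintegral_roundLaw (measurable_one.indicator (measurable_roundProposal hA))]
  have h := lintegral_studentProposal (φ := A.indicator 1) (measurable_one.indicator hA)
  rw [← lintegral_indicator hA]
  calc _ = ∫⁻ y₁, ∫⁻ y₂, ∫⁻ w, A.indicator 1 (studentProposal y₁ y₂ w)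
      ∂chiSqOne ∂gaussianReal 0 1 ∂gaussianReal 0 1 := by
        refine lintegral_congr fun y₁ => lintegral_congr fun y₂ => lintegral_congr fun w => ?_
        have : ∀ v₁ v₂ : ℝ, (roundProposal ⁻¹' A).indicator (1 : (Fin 5 → ℝ) → ℝ≥0∞)
            ![y₁, y₂, w, v₁, v₂] = A.indicator 1 (studentProposal y₁ y₂ w) := fun _ _ => rfl
        simp [this]
    _ = _ := h
    _ = _ := lintegral_congr fun x => by
        by_cases hx : x ∈ A <;> simp [hx]

/-- The samples drawn in round `m`. -/
def roundData (N W : ℕ → ℝ) (m : ℕ) : Fin 5 → ℝ :=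
  ![N (4 * m), N (4 * m + 1), W m, N (4 * m + 2), N (4 * m + 3)]

/-- The position of the sample `j` of round `m` in the two sequences of samples. -/
def roundIndex (p : ℕ × Fin 5) : ℕ ⊕ ℕ :=
  ![.inl (4 * p.1), .inl (4 * p.1 + 1), .inr p.1, .inl (4 * p.1 + 2), .inl (4 * p.1 + 3)] p.2

lemma roundIndex_injective : Function.Injective roundIndex := by
  rintro ⟨m, j⟩ ⟨m', j'⟩ h
  fin_cases j <;> fin_cases j' <;> simp [roundIndex] at h ⊢ <;> omega

/-- Rounds use disjoint blocks of the two sample streams: `roundIndex` is injective, so reindexing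
preserves independence, and currying groups the samples into i.i.d. rounds. -/
lemma hasLaw_roundData {Ω : Type*} [MeasurableSpace Ω] {P : Measure Ω} [IsProbabilityMeasure P]
    {N W : ℕ → Ω → ℝ} (hN : ∀ i, HasLaw (N i) (gaussianReal 0 1) P)
    (hW : ∀ j, HasLaw (W j) chiSqOne P)
    (hNW : iIndepFun (Sum.elim N W : ℕ ⊕ ℕ → Ω → ℝ) P) :
    HasLaw (fun ω => roundData (fun i => N i ω) (fun j => W j ω))
      (Measure.infinitePi fun _ : ℕ => roundLaw) P := by
  have hX : ∀ p : ℕ × Fin 5, HasLaw ((Sum.elim N W : ℕ ⊕ ℕ → Ω → ℝ) (roundIndex p))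
      (roundSource p.2) P := by
    rintro ⟨m, j⟩
    fin_cases j
    exacts [hN _, hN _, hW _, hN _, hN _]
  have h1 := (hNW.precomp roundIndex_injective).hasLaw_infinitePi hX
    (aemeasurable_pi_iff.2 fun p => (hX p).aemeasurable)
  have h2 : HasLaw (MeasurableEquiv.curry ℕ (Fin 5) ℝ)
      (Measure.infinitePi fun _ : ℕ => roundLaw)
      (Measure.infinitePi fun p : ℕ × Fin 5 => roundSource p.2) :=
    ⟨(MeasurableEquiv.measurable _).aemeasurable,
      Measure.infinitePi_map_curry (fun (_ : ℕ) (j : Fin 5) => roundSource j)⟩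
  convert h2.comp h1 using 1
  ext ω m j
  fin_cases j <;> rfl

section Unfold

variable (N W : ℕ → ℝ)

/-- Every path through a round draws four normals and one χ² sample, so block positions are
deterministic even though the halting time is random. -/
lemma used_ciRound (m : ℕ) : ciRound.used N W m = (4 * m, m) := by
  induction m with
  | zero => rfl
  | succ m ih =>
    rw [SamplingTree.used, ih]
    rfl

open Classical in
lemma result_ciRound (m : ℕ) : ciRound.result N W m =
    if roundData N W m ∈ roundAccept then some (roundProposal (roundData N W m)) else none := by
  rw [SamplingTree.result, used_ciRound]
  rfl

lemma isSome_result_ciRound (m : ℕ) :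
    (ciRound.result N W m).isSome ↔ roundData N W m ∈ roundAccept := by
  rw [result_ciRound]
  split_ifs with h <;> simp [h]

lemma halts_ciRound : ciRound.Halts N W ↔ ∃ m, roundData N W m ∈ roundAccept := by
  simp_rw [SamplingTree.Halts, isSome_result_ciRound]

lemma haltRound_ciRound : ciRound.haltRound N W = firstHit roundAccept (roundData N W) := by
  simp_rw [SamplingTree.haltRound, isSome_result_ciRound]
  rfl

lemma output_ciRound (h : ∃ m, roundData N W m ∈ roundAccept) : ciRound.output N W
    = roundProposal (roundData N W (firstHit roundAccept (roundData N W))) := by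
  rw [SamplingTree.output, haltRound_ciRound, result_ciRound, if_pos (firstHit_mem h)]
  rfl

open Classical in
lemma chiSqsUsed_ciRound : ciRound.chiSqsUsed N W
    = if ∃ m, roundData N W m ∈ roundAccept
      then (firstHit roundAccept (roundData N W) : ℝ≥0∞) + 1 else ∞ := by
  rw [SamplingTree.chiSqsUsed, used_ciRound, haltRound_ciRound]
  refine if_congr (halts_ciRound N W) ?_ rfl
  push_cast
  rfl

lemma normalsUsed_ciRound : ciRound.normalsUsed N W = 4 * ciRound.chiSqsUsed N W := by
  rw [SamplingTree.normalsUsed, SamplingTree.chiSqsUsed, used_ciRound]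
  split_ifs
  · push_cast
    rfl
  · simp

end Unfold

lemma lintegral_chiSqsUsed {Ω : Type*} [MeasurableSpace Ω] {P : Measure Ω}
    {N W : ℕ → Ω → ℝ}
    (h : HasLaw (fun ω => roundData (fun i => N i ω) (fun j => W j ω))
      (Measure.infinitePi fun _ : ℕ => roundLaw) P) :
    ∫⁻ ω, ciRound.chiSqsUsed (fun i => N i ω) (fun j => W j ω) ∂P
      = ENNReal.ofReal (25 / Real.pi) := by
  have hpi := Real.pi_pos
  simp_rw [chiSqsUsed_ciRound]
  have h1 := lintegral_firstHit_add_one roundLaw measurableSet_roundAccept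
  rw [← h.map_eq, lintegral_map' (measurable_firstHit_add_one measurableSet_roundAccept).aemeasurable
      h.aemeasurable, roundLaw_accept,
    ← ENNReal.ofReal_inv_of_pos (by positivity), inv_div] at h1
  rw [← h1]

theorem corollary4p4
    {Ω : Type*} [MeasurableSpace Ω] (P : Measure Ω) [IsProbabilityMeasure P]
    -- the sources of samples: all `N i` and all `W j` are mutually independent
    (N W : ℕ → Ω → ℝ)
    (hN : ∀ i, HasLaw (N i) (gaussianReal 0 1) P)
    (hW : ∀ j, HasLaw (W j) chiSqOne P)
    (hNW : iIndepFun (Sum.elim N W : ℕ ⊕ ℕ → Ω → ℝ) P) :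
    -- the proposals have the Student density, and this is an envelope for the target density
    HasLaw (fun ω => studentProposal (N 0 ω) (N 1 ω) (W 0 ω))
      (volume.withDensity fun x => ENNReal.ofReal (studentDensity x)) P ∧
    (∀ x, ciDensity x ≤ 25 / Real.pi * studentDensity x) ∧
    -- the rejection sampler halts almost surely
    (∀ᵐ ω ∂P, ciRound.Halts (fun i => N i ω) (fun j => W j ω)) ∧
    -- the law of its output is exactly the law `CI₁(0, 1)` of the stochastic integral of `(1, x)`
    (∀ {Ω' : Type*} [MeasurableSpace Ω'] (P' : Measure Ω') [IsProbabilityMeasure P']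
        (L : ℝ → Ω' → ℝ) (Z : Ω' → EuclideanSpace ℝ (Fin 2)),
      IsCauchyMotion L P' → IsStochIntegral L P' oneX 0 1 Z →
      HasLaw (fun ω => ciRound.output (fun i => N i ω) (fun j => W j ω)) (P'.map Z) P) ∧
    -- the expected numbers of samples used
    ∫⁻ ω, ciRound.normalsUsed (fun i => N i ω) (fun j => W j ω) ∂P
      = ENNReal.ofReal (100 / Real.pi) ∧
    ∫⁻ ω, ciRound.chiSqsUsed (fun i => N i ω) (fun j => W j ω) ∂P
      = ENNReal.ofReal (25 / Real.pi) := by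
  have hpi := Real.pi_pos
  have hdata := hasLaw_roundData hN hW hNW
  have hacc : roundLaw roundAccept ≠ 0 := by
    rw [roundLaw_accept]
    simpa using by positivity
  have hhalt : ∀ᵐ ω ∂P, ∃ m, roundData (fun i => N i ω) (fun j => W j ω) m ∈ roundAccept := by
    have h := ae_exists_mem roundLaw measurableSet_roundAccept hacc
    rw [← hdata.map_eq] at h
    exact ae_of_ae_map hdata.aemeasurable h
  refine ⟨?_, fun x => (le_abs_self _).trans (abs_ciDensity_le x), ?_, ?_, ?_,
    lintegral_chiSqsUsed hdata⟩
  · have h0 : HasLaw (fun x : ℕ → Fin 5 → ℝ => x 0) roundLaw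
        (Measure.infinitePi fun _ : ℕ => roundLaw) :=
      ⟨(measurable_pi_apply 0).aemeasurable, Measure.infinitePi_map_eval _ 0⟩
    exact (HasLaw.comp ⟨measurable_roundProposal.aemeasurable, map_roundProposal⟩ h0).comp hdata
  · filter_upwards [hhalt] with ω hω
    exact (halts_ciRound _ _).2 hω
  · intro Ω' _ P' _ L Z hL hZ
    rw [map_stochIntegral_oneX hL hZ]
    have h1 : HasLaw (fun x : ℕ → Fin 5 → ℝ => x (firstHit roundAccept x)) (roundLaw[|roundAccept])
        (Measure.infinitePi fun _ : ℕ => roundLaw) :=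
      ⟨(measurable_apply_firstHit measurableSet_roundAccept).aemeasurable,
        map_apply_firstHit roundLaw measurableSet_roundAccept hacc⟩
    -- The output agrees with the first accepted proposal only when the sampler halts, hence the
    -- almost-everywhere congruence.
    refine ((HasLaw.comp ⟨measurable_roundProposal.aemeasurable, map_roundProposal_cond⟩
      h1).comp hdata).congr ?_
    filter_upwards [hhalt] with ω hω
    exact output_ciRound _ _ hω
  · simp_rw [normalsUsed_ciRound]
    rw [lintegral_const_mul' _ _ (by simp), lintegral_chiSqsUsed hdata,
      ← ENNReal.ofReal_ofNat 4, ← ENNReal.ofReal_mul (by norm_num)]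
    congr 1
    ring
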